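/- Let $A$ be an associative algebra over $\mathbb{C}$, $\sigma$ an automorphism of $A$, $H$ a complex Hilbert space on which $A$ acts by bounded operators, and $D$ a self-adjoint (in general unbounded) operator on $H$ with compact resolvent such that, for every $a\in A$, $a$ preserves $\mathrm{dom}\,D$ and $Da-\sigma(a)D$ extends to a bounded operator $d_\sigma(a)$ on $H$; that is, $(A,H,D)$ is a $\sigma$-spectral triple. It is graded if it comes with $\gamma=\gamma^*\in\mathcal L(H)$, $\gamma^2=1$, which commutes with the action of $A$ and satisfies $D\gamma=-\gamma D$. It is Lipschitz-regular if for every $a\in A$ the operator $|D|a-\sigma(a)|D|$ is bounded (in the same sense). Let $\mu_0(T)\ge\mu_1(T)\ge\cdots$ be the singular values of a bounded operator $T$, and let $\mathcal L^{p,\infty}$ be the ideal of all $T$ with $\sum_{k<N}\mu_k(T)=O(N^{1-1/p})$ if $p>1$, and $\sum_{k<N}\mu_k(T)=O(\log N)$ if $p=1$. Let $\mathrm{Tr}_\omega$ be the Dixmier trace on $\mathcal L^{1,\infty}$ defined by $\mathrm{Tr}_\omega(T)=\mathrm{Lim}_\omega\,\frac1{\log N}\sum_{k<N}\mu_k(T)$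 for $T\ge0$ and extended by linearity, where $\mathrm{Lim}_\omega$ is any positive linear form on bounded real sequences that extends the ordinary limit and satisfies $\mathrm{Lim}_\omega(\alpha_0,\alpha_0,\alpha_1,\alpha_1,\dots)=\mathrm{Lim}_\omega(\alpha_0,\alpha_1,\dots)$. Suppose that $D$ is invertible and that $D^{-1}\in\mathcal L^{n,\infty}$ for an integer $n\ge1$. (1) If the triple is graded and $n$ is even, then the formula $$\Psi_{D,\sigma}(a^0,\dots,a^n)=\mathrm{Tr}_\omega\bigl(\gamma\,a^0\,d_\sigma(\sigma^{-1}(a^1))\cdots d_\sigma(\sigma^{-n}(a^n))\,D^{-n}\bigr),\qquad a^0,\dots,a^n\in A,$$ is well defined (the operator belongs to $\mathcal L^{1,\infty}$), and $\Psi_{D,\sigma}$ is an $(n+1)$-linear form on $A$ which is a Hochschild cocycle in $Z^n(A,A^*)$: for all $a^0,\dots,a^{n+1}\in A$, $$\sum_{i=0}^n(-1)^i\,\Psi_{D,\sigma}(a^0,\dots,a^ia^{i+1},\dots,a^{n+1})+(-1)^{n+1}\,\Psi_{D,\sigma}(a^{n+1}a^0,a^1,\dots,a^n)=0.$$ (2)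 If the triple is ungraded and Lipschitz-regular and $n$ is odd, then the same holds for $$\Psi_{D,\sigma}(a^0,\dots,a^n)=\mathrm{Tr}_\omega\bigl(a^0\,d_\sigma(\sigma^{-1}(a^1))\cdots d_\sigma(\sigma^{-n}(a^n))\,|D|^{-n}\bigr).$$ -/

import Mathlib

open Filter Topology
open scoped BoundedContinuousFunction ComplexStarModule InnerProductSpace

noncomputable section

/-! ## Singular values, weak Schatten ideals, Dixmier traces -/

section Ideals

variable {H : Type*} [NormedAddCommGroup H] [InnerProductSpace ℂ H] [CompleteSpace H]

/-- The `k`-th singular value `μ_k(T)`, `k = 0, 1, 2, …`, of a bounded operator: its distance, in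
the operator norm, to the set of operators of rank at most `k`. -/
def singVal (T : H →L[ℂ] H) (k : ℕ) : ℝ :=
  sInf {r : ℝ | ∃ R : H →L[ℂ] H, LinearMap.rank (R : H →ₗ[ℂ] H) ≤ (k : Cardinal) ∧ r = ‖T - R‖}

/-- `σ_N(T) = ∑_{k < N} μ_k(T)`. -/
def singSum (T : H →L[ℂ] H) (N : ℕ) : ℝ := ∑ k ∈ Finset.range N, singVal T k

/-- The ideal `𝓛^{p,∞}` for an integer `p ≥ 1`: operators with `σ_N(T) = O(log N)` if `p = 1`
and `σ_N(T) = O(N^{1 - 1/p})` if `p > 1`. -/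
def MemWeakSchatten (p : ℕ) (T : H →L[ℂ] H) : Prop :=
  ∃ C : ℝ, ∀ N : ℕ, 2 ≤ N →
    singSum T N ≤ C * (if p = 1 then Real.log N else (N : ℝ) ^ (1 - 1 / (p : ℝ)))

/-- The limiting procedures `Lim_ω` on bounded sequences that define the Dixmier traces: positive
linear forms that extend the ordinary limit and satisfy
`Lim_ω (α₀, α₀, α₁, α₁, α₂, α₂, …) = Lim_ω (α₀, α₁, α₂, …)`. -/
structure DixmierLimit where
  lim : (ℕ →ᵇ ℝ) →ₗ[ℝ] ℝ
  nonneg : ∀ f : ℕ →ᵇ ℝ, (∀ k, 0 ≤ f k) → 0 ≤ lim f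
  of_tendsto : ∀ (f : ℕ →ᵇ ℝ) (l : ℝ), Tendsto f atTop (𝓝 l) → lim f = l
  double : ∀ f : ℕ →ᵇ ℝ,
    lim (f.compContinuous ⟨fun k => k / 2, continuous_of_discreteTopology⟩) = lim f

open Classical in
/-- `Lim_ω α` for a bounded real sequence `α` (and `0` if `α` is unbounded). -/
def DixmierLimit.ofSeq (ω : DixmierLimit) (α : ℕ → ℝ) : ℝ :=
  if h : ∃ C : ℝ, ∀ k, ‖α k‖ ≤ C then
    ω.lim (BoundedContinuousFunction.ofNormedAddCommGroupDiscrete α h.choose h.choose_spec)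
  else 0

/-- `Lim_ω (σ_N(T) / log N)`, the value of the Dixmier trace on a positive `T ∈ 𝓛^{1,∞}`. -/
def DixmierLimit.tracePos (ω : DixmierLimit) (T : H →L[ℂ] H) : ℝ :=
  ω.ofSeq fun N => singSum T N / Real.log N

/-- The Dixmier trace `Tr_ω` of a self-adjoint `S ∈ 𝓛^{1,∞}`, by the decomposition
`S = S⁺ - S⁻` into positive operators. -/
def DixmierLimit.traceSA (ω : DixmierLimit) (S : H →L[ℂ] H) : ℝ :=
  ω.tracePos S⁺ - ω.tracePos S⁻

/-- The Dixmier trace `Tr_ω` on `𝓛^{1,∞}`, extended from the positive operators by linearity,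
through `T = ℜ T + i ℑ T`. -/
def DixmierLimit.trace (ω : DixmierLimit) (T : H →L[ℂ] H) : ℂ :=
  (ω.traceSA (ℜ T : H →L[ℂ] H) : ℂ) + Complex.I * (ω.traceSA (ℑ T : H →L[ℂ] H) : ℂ)

end Ideals

/-! ## Unbounded operators -/

section Unbounded

variable {H : Type*} [NormedAddCommGroup H] [InnerProductSpace ℂ H] [CompleteSpace H]

/-- The bounded operator `R` is the resolvent `(D - z)⁻¹` of the unbounded operator `D`. -/
def IsResolvent (D : H →ₗ.[ℂ] H) (z : ℂ) (R : H →L[ℂ] H) : Prop :=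
  (∀ y : H, ∃ h : R y ∈ D.domain, D ⟨R y, h⟩ - z • R y = y) ∧
    ∀ x : D.domain, R (D x - z • (x : H)) = x

/-- `D` has a bounded, everywhere defined inverse. -/
def HasBoundedInverse (D : H →ₗ.[ℂ] H) : Prop := ∃ R : H →L[ℂ] H, IsResolvent D 0 R

open Classical in
/-- The bounded operator `D⁻¹` (and `0` if `D` has no bounded inverse). -/
def boundedInverse (D : H →ₗ.[ℂ] H) : H →L[ℂ] H :=
  if h : HasBoundedInverse D then h.choose else 0

/-- The operator `|D|⁻¹ = |D⁻¹|`, for an invertible self-adjoint `D`. -/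
def absInverse (D : H →ₗ.[ℂ] H) : H →L[ℂ] H := CFC.abs (boundedInverse D)

/-- The unbounded operator `|D| = |D⁻¹|⁻¹`, for an invertible self-adjoint `D`; its domain is the
range of `|D⁻¹|`. It is the absolute value of `D` by `unboundedAbs_spec` below. -/
def unboundedAbs (D : H →ₗ.[ℂ] H) : H →ₗ.[ℂ] H :=
  ((absInverse D : H →ₗ[ℂ] H).toPMap ⊤).inverse

/-- `B` is the bounded extension of the operator `D S - T D`, defined on `dom D`. -/
def IsTwistedCommutator (D : H →ₗ.[ℂ] H) (S T B : H →L[ℂ] H) : Prop :=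
  ∀ x : D.domain, ∃ h : S x ∈ D.domain, B x = D ⟨S x, h⟩ - T (D x)


theorem IsResolvent.isSelfAdjoint_inverse {D : H →ₗ.[ℂ] H} (hD : IsSelfAdjoint D)
    {R : H →L[ℂ] H} (hR : IsResolvent D 0 R) : IsSelfAdjoint R := by
  rw [ContinuousLinearMap.isSelfAdjoint_iff_isSymmetric]
  intro y z
  obtain ⟨h1, e1⟩ := hR.1 y
  obtain ⟨h2, e2⟩ := hR.1 z
  have h := LinearPMap.adjoint_isFormalAdjoint hD.dense_domain
  rw [LinearPMap.isSelfAdjoint_def.mp hD] at h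
  have := h ⟨R y, h1⟩ ⟨R z, h2⟩
  simp only [zero_smul, sub_zero] at e1 e2
  rw [e1, e2] at this
  exact this.symm

theorem IsResolvent.isSelfAdjoint_of_inverse {P : H →ₗ.[ℂ] H} {R : H →L[ℂ] H}
    (hP : IsResolvent P 0 R) (hR : IsSelfAdjoint R) : IsSelfAdjoint P := by
  have hs : ∀ x y : H, ⟪R x, y⟫_ℂ = ⟪x, R y⟫_ℂ :=
    (ContinuousLinearMap.isSelfAdjoint_iff_isSymmetric.mp hR)
  have hP1 : ∀ y : H, ∃ h : R y ∈ P.domain, P ⟨R y, h⟩ = y := by simpa using hP.1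
  have hP2 : ∀ x : P.domain, R (P x) = x := by simpa using hP.2
  have hd : Dense (P.domain : Set H) := by
    rw [Submodule.dense_iff_topologicalClosure_eq_top,
      Submodule.topologicalClosure_eq_top_iff, Submodule.eq_bot_iff]
    intro v hv
    have h0 : R v = 0 := by
      rw [← inner_self_eq_zero (𝕜 := ℂ), hs]
      exact Submodule.inner_left_of_mem_orthogonal (hP1 _).1 hv
    obtain ⟨h, e⟩ := hP1 v
    rw [← e]
    have : (⟨R v, h⟩ : P.domain) = 0 := Subtype.ext h0
    rw [this, LinearPMap.map_zero]
  have hsym : P.IsFormalAdjoint P := by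
    intro x y
    rw [← hP2 x, ← hP2 y]
    have := hs (P x) (P y)
    rw [hP2, hP2] at this
    simp only [hP2]
    exact this.symm
  have hle := hsym.le_adjoint hd
  rw [LinearPMap.isSelfAdjoint_def]
  refine (LinearPMap.eq_of_le_of_domain_eq hle (le_antisymm hle.1 ?_)).symm
  intro y hy
  have key : y = R (P.adjoint ⟨y, hy⟩) := by
    refine ext_inner_right ℂ fun z => ?_
    obtain ⟨h, e⟩ := hP1 z
    have := LinearPMap.adjoint_isFormalAdjoint hd ⟨y, hy⟩ ⟨R z, h⟩
    rw [e] at this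
    rw [hs, this]
  rw [key]
  exact (hP1 _).1

theorem exists_eq_of_norm_eq {S T : H →L[ℂ] H} (hS : IsSelfAdjoint S) (hT : IsSelfAdjoint T)
    (h : ∀ z, ‖S z‖ = ‖T z‖) (y : H) : ∃ w, S w = T y := by
  have hs : ∀ x y : H, ⟪S x, y⟫_ℂ = ⟪x, S y⟫_ℂ :=
    (ContinuousLinearMap.isSelfAdjoint_iff_isSymmetric.mp hS)
  have ht : ∀ x y : H, ⟪T x, y⟫_ℂ = ⟪x, T y⟫_ℂ :=
    (ContinuousLinearMap.isSelfAdjoint_iff_isSymmetric.mp hT)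
  let p : Submodule ℂ H := LinearMap.range (S : H →ₗ[ℂ] H)
  have hc : ∀ x : p, S (Classical.choose x.2) = x := fun x => Classical.choose_spec x.2
  have hw : ∀ z z', S z = S z' → T z = T z' := by
    intro z z' e
    rw [← sub_eq_zero, ← map_sub, ← norm_eq_zero, ← h, map_sub, e, sub_self, norm_zero]
  let f : p →ₗ[ℂ] ℂ :=
    { toFun := fun x => ⟪y, T (Classical.choose x.2)⟫_ℂ
      map_add' := fun a b => by
        rw [← inner_add_right, ← map_add]
        congr 1
        apply hw
        rw [map_add, hc, hc, hc]; rfl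
      map_smul' := fun c a => by
        rw [RingHom.id_apply, smul_eq_mul, ← inner_smul_right, ← map_smul]
        congr 1
        apply hw
        rw [map_smul, hc, hc]; rfl }
  let g : StrongDual ℂ p := f.mkContinuous ‖y‖ fun x => by
    refine (norm_inner_le_norm _ _).trans (le_of_eq ?_)
    rw [← h, hc]; rfl
  obtain ⟨G, hG, -⟩ := exists_extension_norm_eq p g
  refine ⟨(InnerProductSpace.toDual ℂ H).symm G, ext_inner_right ℂ fun z => ?_⟩
  rw [hs, InnerProductSpace.toDual_symm_apply, ht]
  have h1 := hG ⟨S z, z, rfl⟩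
  have h2 : g ⟨S z, z, rfl⟩ = ⟪y, T z⟫_ℂ := by
    change ⟪y, T _⟫_ℂ = _
    congr 1
    exact hw _ _ (hc ⟨S z, z, rfl⟩)
  exact h1.trans h2

/-- For an invertible self-adjoint `D`, the operator `unboundedAbs D` is the absolute value of `D`:
the positive self-adjoint operator `P` with `dom P = dom D` and `‖P x‖ = ‖D x‖` on this domain,
that is, `P² = D²`; and `absInverse D` is its inverse. -/
theorem unboundedAbs_spec {D : H →ₗ.[ℂ] H} (hD : IsSelfAdjoint D) (hinv : HasBoundedInverse D) :
    IsSelfAdjoint (unboundedAbs D) ∧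
    (∀ x : (unboundedAbs D).domain, 0 ≤ (⟪unboundedAbs D x, (x : H)⟫_ℂ).re) ∧
    (unboundedAbs D).domain = D.domain ∧
    (∀ (x : (unboundedAbs D).domain) (y : D.domain), (x : H) = y → ‖unboundedAbs D x‖ = ‖D y‖) ∧
    IsResolvent (unboundedAbs D) 0 (absInverse D) := by
  have hR : IsResolvent D 0 (boundedInverse D) := by
    rw [boundedInverse, dif_pos hinv]; exact hinv.choose_spec
  have hRs := hR.isSelfAdjoint_inverse hD
  have hA0 : (0 : H →L[ℂ] H) ≤ absInverse D := CFC.abs_nonneg _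
  have hAs : IsSelfAdjoint (absInverse D) := IsSelfAdjoint.of_nonneg hA0
  have hsq : absInverse D * absInverse D = boundedInverse D * boundedInverse D := by
    rw [absInverse, CFC.abs_mul_abs, hRs.star_eq]
  set R := boundedInverse D with hRdef
  set A := absInverse D with hAdef
  have hs : ∀ x y : H, ⟪R x, y⟫_ℂ = ⟪x, R y⟫_ℂ :=
    (ContinuousLinearMap.isSelfAdjoint_iff_isSymmetric.mp hRs)
  have ha : ∀ x y : H, ⟪A x, y⟫_ℂ = ⟪x, A y⟫_ℂ :=
    (ContinuousLinearMap.isSelfAdjoint_iff_isSymmetric.mp hAs)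
  have hnorm : ∀ z, ‖A z‖ = ‖R z‖ := by
    intro z
    have : ⟪A z, A z⟫_ℂ = ⟪R z, R z⟫_ℂ := by
      rw [ha, hs]
      exact congrArg (fun S : H →L[ℂ] H => ⟪z, S z⟫_ℂ) hsq
    rw [inner_self_eq_norm_sq_to_K, inner_self_eq_norm_sq_to_K] at this
    exact (pow_left_inj₀ (norm_nonneg _) (norm_nonneg _) two_ne_zero).mp (by exact_mod_cast this)
  have hR1 : ∀ y : H, ∃ h : R y ∈ D.domain, D ⟨R y, h⟩ = y := by simpa using hR.1
  have hR2 : ∀ x : D.domain, R (D x) = x := by simpa using hR.2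
  have hRinj : ∀ z, R z = 0 → z = 0 := by
    intro z hz
    obtain ⟨h, e⟩ := hR1 z
    rw [← e]
    have : (⟨R z, h⟩ : D.domain) = 0 := Subtype.ext hz
    rw [this, LinearPMap.map_zero]
  have hker : ((A : H →ₗ[ℂ] H).toPMap ⊤).toFun.ker = ⊥ := by
    rw [LinearMap.ker_eq_bot']
    intro m hm
    have hm' : A (m : H) = 0 := hm
    apply Subtype.ext
    exact hRinj _ (by rw [← norm_eq_zero, ← hnorm, hm', norm_zero])
  have hdom : ∀ x, x ∈ (unboundedAbs D).domain ↔ ∃ z, A z = x := by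
    intro x
    rw [unboundedAbs, LinearPMap.inverse_domain]
    constructor
    · rintro ⟨z, hz⟩; exact ⟨z, hz⟩
    · rintro ⟨z, hz⟩; exact ⟨⟨z, trivial⟩, hz⟩
  have happ : ∀ (x : (unboundedAbs D).domain) (z : H), A z = x → unboundedAbs D x = z := by
    intro x z hz
    exact LinearPMap.inverse_apply_eq hker (x := ⟨z, trivial⟩) (y := x) hz
  have hAbs : IsResolvent (unboundedAbs D) 0 A := by
    constructor
    · intro y
      refine ⟨(hdom _).2 ⟨y, rfl⟩, ?_⟩
      rw [zero_smul, sub_zero]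
      exact happ _ _ rfl
    · intro x
      obtain ⟨z, hz⟩ := (hdom _).1 x.2
      rw [zero_smul, sub_zero, happ x z hz, hz]
  refine ⟨hAbs.isSelfAdjoint_of_inverse hAs, ?_, ?_, ?_, hAbs⟩
  · intro x
    obtain ⟨z, hz⟩ := (hdom _).1 x.2
    rw [happ x z hz, ← hz, ← ha]
    exact ((ContinuousLinearMap.nonneg_iff_isPositive A).mp hA0).re_inner_nonneg_left z
  · ext x
    rw [hdom]
    constructor
    · rintro ⟨z, rfl⟩
      obtain ⟨w, hw⟩ := exists_eq_of_norm_eq hRs hAs (fun z => (hnorm z).symm) z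
      rw [← hw]; exact (hR1 w).1
    · intro hx
      obtain ⟨w, hw⟩ := exists_eq_of_norm_eq hAs hRs hnorm (D ⟨x, hx⟩)
      exact ⟨w, by rw [hw, hR2]⟩
  · intro x y hxy
    obtain ⟨z, hz⟩ := (hdom _).1 x.2
    rw [happ x z hz]
    -- it remains to see that `‖z‖ = ‖D y‖` when `A z = R (D y)`
    have e1 : A z = R (D y) := by rw [hR2, hz, hxy]
    have e2 : ∀ v, ⟪z, A v⟫_ℂ = ⟪D y, R v⟫_ℂ := fun v => by rw [← ha, e1, hs]
    have hdA : Dense ((unboundedAbs D).domain : Set H) :=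
      (hAbs.isSelfAdjoint_of_inverse hAs).dense_domain
    have bound : ∀ (S T : H →L[ℂ] H) (u u' : H), (∀ v, ⟪u, S v⟫_ℂ = ⟪u', T v⟫_ℂ) →
        (∀ v, ‖S v‖ = ‖T v‖) → (∀ x, ∀ ε > 0, ∃ v, ‖x - S v‖ < ε) → ‖u‖ ≤ ‖u'‖ := by
      intro S T u u' e hn hdense
      have hcl : ∀ x, ‖⟪u, x⟫_ℂ‖ ≤ ‖u'‖ * ‖x‖ := by
        have hd : DenseRange S := by
          intro x
          rw [Metric.mem_closure_iff]
          intro ε hε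
          obtain ⟨v, hv⟩ := hdense x ε hε
          exact ⟨S v, ⟨v, rfl⟩, by rwa [dist_eq_norm]⟩
        intro x
        refine hd.induction_on (p := fun x => ‖⟪u, x⟫_ℂ‖ ≤ ‖u'‖ * ‖x‖) x ?_ ?_
        · exact isClosed_le (by fun_prop) (by fun_prop)
        · intro v
          rw [e, hn]
          exact norm_inner_le_norm _ _
      have := hcl u
      rw [inner_self_eq_norm_sq_to_K] at this
      by_cases h0 : ‖u‖ = 0
      · rw [h0]; exact norm_nonneg _
      · have hpos : 0 < ‖u‖ := lt_of_le_of_ne (norm_nonneg _) (Ne.symm h0)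
        have h3 : ‖u‖ * ‖u‖ ≤ ‖u'‖ * ‖u‖ := by
          simpa [sq] using this
        exact le_of_mul_le_mul_right h3 hpos
    have dense_of : ∀ (P : H →ₗ.[ℂ] H) (S : H →L[ℂ] H), Dense (P.domain : Set H) →
        (∀ x ∈ P.domain, ∃ v, S v = x) → ∀ x, ∀ ε > 0, ∃ v, ‖x - S v‖ < ε := by
      intro P S hP hS x ε hε
      obtain ⟨x', hx', hd⟩ := Metric.mem_closure_iff.mp (hP x) ε hε
      obtain ⟨v, rfl⟩ := hS x' hx'
      exact ⟨v, by rwa [dist_eq_norm] at hd⟩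
    apply le_antisymm
    · exact bound A R z (D y) e2 hnorm (dense_of _ A hdA fun x hx => (hdom x).1 hx)
    · exact bound R A (D y) z (fun v => (e2 v).symm) (fun v => (hnorm v).symm)
        (dense_of _ R hD.dense_domain fun x hx => ⟨D ⟨x, hx⟩, hR2 _⟩)

end Unbounded

/-! ## Spectral triples twisted by an automorphism -/

/-- An (ungraded) `σ`-spectral triple `(A, H, D)`. -/
structure SigmaSpectralTriple (A H : Type*) [NonUnitalRing A] [Module ℂ A]
    [IsScalarTower ℂ A A] [SMulCommClass ℂ A A]
    [NormedAddCommGroup H] [InnerProductSpace ℂ H] [CompleteSpace H] where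
  /-- the automorphism `σ` of the complex algebra `A` -/
  σ : A ≃+* A
  σ_smul : ∀ (c : ℂ) (a : A), σ (c • a) = c • σ a
  /-- the action of `A` on `H` -/
  π : A →ₙₐ[ℂ] (H →L[ℂ] H)
  /-- the unbounded operator `D` -/
  D : H →ₗ.[ℂ] H
  selfAdjoint : IsSelfAdjoint D
  compactResolvent : ∃ (z : ℂ) (R : H →L[ℂ] H), IsResolvent D z R ∧ IsCompactOperator R
  bounded_twistedCommutator : ∀ a : A, ∃ B : H →L[ℂ] H, IsTwistedCommutator D (π a) (π (σ a)) B

/-- A graded `σ`-spectral triple, with grading operator `γ`. -/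
structure GradedSigmaSpectralTriple (A H : Type*) [NonUnitalRing A] [Module ℂ A]
    [IsScalarTower ℂ A A] [SMulCommClass ℂ A A]
    [NormedAddCommGroup H] [InnerProductSpace ℂ H] [CompleteSpace H]
    extends SigmaSpectralTriple A H where
  γ : H →L[ℂ] H
  γ_selfAdjoint : IsSelfAdjoint γ
  γ_sq : γ * γ = 1
  γ_comm : ∀ a : A, γ * π a = π a * γ
  γ_anticomm : ∀ x : D.domain, ∃ h : γ x ∈ D.domain, D ⟨γ x, h⟩ = -γ (D x)

namespace SigmaSpectralTriple

variable {A H : Type*} [NonUnitalRing A] [Module ℂ A] [IsScalarTower ℂ A A] [SMulCommClass ℂ A A]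
  [NormedAddCommGroup H] [InnerProductSpace ℂ H] [CompleteSpace H]

/-- The twisted derivation `d_σ(a) = D a - σ(a) D`, as a bounded operator (it is unique since
`dom D` is dense). -/
def d (𝒯 : SigmaSpectralTriple A H) (a : A) : H →L[ℂ] H :=
  (𝒯.bounded_twistedCommutator a).choose

/-- Lipschitz regularity, for invertible `D`: every `|D| a - σ(a) |D|` is bounded. -/
def LipschitzRegular (𝒯 : SigmaSpectralTriple A H) : Prop :=
  ∀ a : A, ∃ B : H →L[ℂ] H,
    IsTwistedCommutator (unboundedAbs 𝒯.D) (𝒯.π a) (𝒯.π (𝒯.σ a)) B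

/-- `D` is invertible and `D⁻¹ ∈ 𝓛^{n,∞}`. -/
def InverseMemWeakSchatten (𝒯 : SigmaSpectralTriple A H) (n : ℕ) : Prop :=
  HasBoundedInverse 𝒯.D ∧ MemWeakSchatten n (boundedInverse 𝒯.D)

/-- The bounded operator `a⁰ d_σ(σ⁻¹(a¹)) d_σ(σ⁻²(a²)) ⋯ d_σ(σ⁻ⁿ(aⁿ))`. -/
def form (𝒯 : SigmaSpectralTriple A H) (n : ℕ) (a : Fin (n + 1) → A) : H →L[ℂ] H :=
  𝒯.π (a 0) * (List.ofFn fun k : Fin n => 𝒯.d (𝒯.σ.symm^[(k : ℕ) + 1] (a k.succ))).prod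

end SigmaSpectralTriple

/-! ## Hochschild cochains -/

section Hochschild

variable {A : Type*} [NonUnitalRing A] [Module ℂ A]

/-- The Hochschild coboundary of an `(n+1)`-linear form `φ` on `A`, seen as an element of
`C^n(A, A^*)`:
`(bφ)(a⁰,…,aⁿ⁺¹) = ∑_{i=0}^n (-1)^i φ(a⁰,…,aⁱaⁱ⁺¹,…,aⁿ⁺¹) + (-1)^{n+1} φ(aⁿ⁺¹a⁰,a¹,…,aⁿ)`. -/
def hochschildCoboundary {n : ℕ} (φ : MultilinearMap ℂ (fun _ : Fin (n + 1) => A) ℂ)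
    (a : Fin (n + 2) → A) : ℂ :=
  ∑ i : Fin (n + 1), (-1) ^ (i : ℕ) * φ (Fin.contractNth i.castSucc (· * ·) a)
    + (-1) ^ (n + 1) *
      φ (Fin.cons (a (Fin.last (n + 1)) * a 0) fun k : Fin n => a k.succ.castSucc)

/-- `φ` is a Hochschild cocycle, `φ ∈ Z^n(A, A^*)`. -/
def IsHochschildCocycle {n : ℕ} (φ : MultilinearMap ℂ (fun _ : Fin (n + 1) => A) ℂ) : Prop :=
  ∀ a : Fin (n + 2) → A, hochschildCoboundary φ a = 0

end Hochschild

end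

/-! ## Singular values -/

section SingularValues

variable {H : Type*} [NormedAddCommGroup H] [InnerProductSpace ℂ H]

/-! The twisted Leibniz rule `d(ab) = d(a) b + σ(a) d(b)` and the powers of `σ⁻¹` in the cochain are
matched: in the alternating sum of contractions everything telescopes except one term, the form of
`a⁰, …, aⁿ` followed by `σ⁻ⁿ(aⁿ⁺¹)` (`sum_neg_one_pow_smul_form_contractNth`). Cocyclicity thus
reduces to moving `σ⁻ⁿ(b)` across `Rⁿ`, where `R` is `D⁻¹` or `|D|⁻¹`, and then cyclically to the
front.

Boundedness of the twisted commutator of `D` or `|D|` gives `a R - R σ(a) = R B R` with `B` bounded.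
Each passage through a factor `R` removes one power of `σ⁻¹` and costs an error with `n + 1` factors
`R`. Since `R` lies in `𝓛^{n,∞}`, this error has summable singular values and a Dixmier trace does
not see it (`trace_mul_twist_mul_pow`). The even and odd cases are both instances of
`exists_hochschildCocycle`.

What remains is that `Tr_ω` is a linear trace on `𝓛^{1,∞}`. On positive operators, Ky Fan's
variational description gives `σ_N(S + T) ≤ σ_N(S) + σ_N(T) ≤ σ_{2N}(S + T)`; invariance of `Lim_ω`
under doubling makes `2N` as good as `N`, hence additivity (`tracePos_add`). Unitary invariance of
singular values, with the fact that unitaries span, gives the trace property (`trace_mul_comm`). -/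

theorem singVal_le {T R : H →L[ℂ] H} {k : ℕ} (hR : LinearMap.rank (R : H →ₗ[ℂ] H) ≤ (k : Cardinal)) :
    singVal T k ≤ ‖T - R‖ :=
  csInf_le ⟨0, by rintro _ ⟨R, -, rfl⟩; exact norm_nonneg _⟩ ⟨R, hR, rfl⟩

theorem exists_rank_le_norm_sub_lt {T : H →L[ℂ] H} {k : ℕ} {c : ℝ} (hc : singVal T k < c) :
    ∃ R : H →L[ℂ] H, LinearMap.rank (R : H →ₗ[ℂ] H) ≤ (k : Cardinal) ∧ ‖T - R‖ < c := by
  obtain ⟨_, ⟨R, hR, rfl⟩, h⟩ := exists_lt_of_csInf_lt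
    (s := {r : ℝ | ∃ R : H →L[ℂ] H, LinearMap.rank (R : H →ₗ[ℂ] H) ≤ (k : Cardinal) ∧ r = ‖T - R‖})
    ⟨_, 0, by simp, rfl⟩ hc
  exact ⟨R, hR, h⟩

theorem singVal_nonneg (T : H →L[ℂ] H) (k : ℕ) : 0 ≤ singVal T k :=
  Real.sInf_nonneg (by rintro _ ⟨R, -, rfl⟩; exact norm_nonneg _)

theorem singVal_le_norm (T : H →L[ℂ] H) (k : ℕ) : singVal T k ≤ ‖T‖ := by
  simpa using singVal_le (T := T) (R := 0) (k := k) (by simp)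

theorem singVal_antitone (T : H →L[ℂ] H) : Antitone (singVal T) := by
  intro j k hjk
  refine le_of_forall_gt_imp_ge_of_dense fun c hc => ?_
  obtain ⟨R, hR, h⟩ := exists_rank_le_norm_sub_lt hc
  exact (singVal_le (hR.trans (by exact_mod_cast hjk))).trans h.le

theorem singVal_add_le (S T : H →L[ℂ] H) (j k : ℕ) :
    singVal (S + T) (j + k) ≤ singVal S j + singVal T k := by
  refine le_of_forall_pos_le_add fun ε hε => ?_
  obtain ⟨P, hP, h1⟩ := exists_rank_le_norm_sub_lt (T := S) (k := j) (lt_add_of_pos_right _ (half_pos hε))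
  obtain ⟨Q, hQ, h2⟩ := exists_rank_le_norm_sub_lt (T := T) (k := k) (lt_add_of_pos_right _ (half_pos hε))
  have hPQ : LinearMap.rank ((P + Q : H →L[ℂ] H) : H →ₗ[ℂ] H) ≤ ((j + k : ℕ) : Cardinal) := by
    push_cast
    exact (LinearMap.rank_add_le _ _).trans (add_le_add hP hQ)
  have := singVal_le (T := S + T) hPQ
  rw [add_sub_add_comm] at this
  linarith [norm_add_le (S - P) (T - Q)]

/-- If `P` and `Q` approximate `S` and `T`, then `P (T - Q) + S Q` has rank at most `j + k` and
leaves the error `(S - P) (T - Q)`. -/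
theorem singVal_mul_le (S T : H →L[ℂ] H) (j k : ℕ) :
    singVal (S * T) (j + k) ≤ singVal S j * singVal T k := by
  refine le_mul_of_forall_lt₀ fun a ha b hb => ?_
  obtain ⟨P, hP, h1⟩ := exists_rank_le_norm_sub_lt ha
  obtain ⟨Q, hQ, h2⟩ := exists_rank_le_norm_sub_lt hb
  have hPQ : LinearMap.rank ((P * (T - Q) + S * Q : H →L[ℂ] H) : H →ₗ[ℂ] H) ≤
      ((j + k : ℕ) : Cardinal) := by
    push_cast
    refine (LinearMap.rank_add_le _ _).trans (add_le_add ?_ ?_)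
    · exact (LinearMap.rank_comp_le_left _ _).trans hP
    · exact (LinearMap.rank_comp_le_right _ _).trans hQ
  have := singVal_le (T := S * T) hPQ
  rw [show S * T - (P * (T - Q) + S * Q) = (S - P) * (T - Q) by noncomm_ring] at this
  refine (this.trans (norm_mul_le _ _)).trans ?_
  exact mul_le_mul h1.le h2.le (norm_nonneg _) ((norm_nonneg _).trans h1.le)

theorem singVal_mul_le_norm_mul (A T : H →L[ℂ] H) (k : ℕ) :
    singVal (A * T) k ≤ ‖A‖ * singVal T k := by
  have := singVal_mul_le A T 0 k
  rw [zero_add] at this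
  exact this.trans (mul_le_mul_of_nonneg_right (singVal_le_norm A 0) (singVal_nonneg T k))

theorem singVal_mul_le_mul_norm (T A : H →L[ℂ] H) (k : ℕ) :
    singVal (T * A) k ≤ singVal T k * ‖A‖ :=
  (singVal_mul_le T A k 0).trans
    (mul_le_mul_of_nonneg_left (singVal_le_norm A 0) (singVal_nonneg T k))

theorem singVal_smul_le (c : ℂ) (T : H →L[ℂ] H) (k : ℕ) :
    singVal (c • T) k ≤ ‖c‖ * singVal T k := by
  have := singVal_mul_le_norm_mul (c • (1 : H →L[ℂ] H)) T k
  rw [smul_mul_assoc, one_mul] at this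
  refine this.trans (mul_le_mul_of_nonneg_right ?_ (singVal_nonneg T k))
  rw [norm_smul]
  exact mul_le_of_le_one_right (norm_nonneg _) ContinuousLinearMap.norm_id_le

theorem singVal_smul (c : ℂ) (T : H →L[ℂ] H) (k : ℕ) :
    singVal (c • T) k = ‖c‖ * singVal T k := by
  refine le_antisymm (singVal_smul_le c T k) ?_
  by_cases hc : c = 0
  · simpa [hc] using singVal_nonneg (0 : H →L[ℂ] H) k
  · have := singVal_smul_le c⁻¹ (c • T) k
    rw [inv_smul_smul₀ hc, norm_inv] at this
    rwa [le_inv_mul_iff₀ (norm_pos_iff.mpr hc)] at this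

theorem singVal_pow_le (T : H →L[ℂ] H) (k n : ℕ) : singVal (T ^ n) (n * k) ≤ singVal T k ^ n := by
  induction n with
  | zero =>
    simpa using (singVal_le_norm (1 : H →L[ℂ] H) 0).trans ContinuousLinearMap.norm_id_le
  | succ n ih =>
    rw [pow_succ, pow_succ, add_mul, one_mul]
    exact (singVal_mul_le _ _ _ _).trans (mul_le_mul_of_nonneg_right ih (singVal_nonneg T k))

/-! ### Partial sums -/

theorem singSum_nonneg (T : H →L[ℂ] H) (N : ℕ) : 0 ≤ singSum T N :=
  Finset.sum_nonneg fun _ _ => singVal_nonneg T _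

theorem singSum_mono (T : H →L[ℂ] H) : Monotone (singSum T) := fun _ _ h =>
  Finset.sum_le_sum_of_subset_of_nonneg (Finset.range_subset_range.mpr h)
    fun _ _ _ => singVal_nonneg T _

/-- By monotonicity each block of `m` consecutive singular values is at most `m` times its first
one. This makes the index shifts in the inequalities for sums and products harmless up to a
constant. -/
theorem singSum_mul_le (T : H →L[ℂ] H) (m N : ℕ) :
    singSum T (m * N) ≤ m * ∑ k ∈ Finset.range N, singVal T (m * k) := by
  induction N with
  | zero => simp [singSum]
  | succ N ih =>
    rw [Finset.sum_range_succ, mul_add_one, singSum, Finset.sum_range_add, mul_add]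
    refine add_le_add ih ?_
    have := Finset.sum_le_card_nsmul (Finset.range m) (fun i => singVal T (m * N + i)) _
      fun i _ => singVal_antitone T (Nat.le_add_right (m * N) i)
    simpa using this

theorem singSum_le_mul_sum (T : H →L[ℂ] H) {m : ℕ} (hm : 0 < m) (N : ℕ) :
    singSum T N ≤ m * ∑ k ∈ Finset.range N, singVal T (m * k) :=
  (singSum_mono T (Nat.le_mul_of_pos_left N hm)).trans (singSum_mul_le T m N)

/-- The constant is crude, but no positivity is needed; it suffices for the ideal property. The
sharp inequality for positive operators is `singSum_add_le`. -/
theorem singSum_add_le_two_mul (S T : H →L[ℂ] H) (N : ℕ) :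
    singSum (S + T) N ≤ 2 * singSum S N + 2 * singSum T N := by
  refine (singSum_le_mul_sum _ two_pos N).trans ?_
  rw [← mul_add, singSum, singSum, ← Finset.sum_add_distrib]
  push_cast
  gcongr with k
  rw [two_mul]
  exact singVal_add_le S T k k

theorem singSum_smul (c : ℂ) (T : H →L[ℂ] H) (N : ℕ) : singSum (c • T) N = ‖c‖ * singSum T N := by
  simp [singSum, singVal_smul, Finset.mul_sum]

theorem singSum_mul_le_norm_mul (A T : H →L[ℂ] H) (N : ℕ) :
    singSum (A * T) N ≤ ‖A‖ * singSum T N := by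
  rw [singSum, singSum, Finset.mul_sum]
  exact Finset.sum_le_sum fun k _ => singVal_mul_le_norm_mul A T k

theorem singSum_mul_le_mul_norm (T A : H →L[ℂ] H) (N : ℕ) :
    singSum (T * A) N ≤ singSum T N * ‖A‖ := by
  rw [singSum, singSum, Finset.sum_mul]
  exact Finset.sum_le_sum fun k _ => singVal_mul_le_mul_norm T A k

theorem singSum_neg (T : H →L[ℂ] H) (N : ℕ) : singSum (-T) N = singSum T N := by
  simpa using singSum_smul (-1) T N

/-! ### Adjoints and absolute values -/

variable [CompleteSpace H]

/-- With `P` the projection onto the finite-dimensional range of `R`, `R = P R` gives `R* = R* P`.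
-/
theorem rank_adjoint_le {R : H →L[ℂ] H} {k : ℕ}
    (hR : LinearMap.rank (R : H →ₗ[ℂ] H) ≤ (k : Cardinal)) :
    LinearMap.rank ((star R : H →L[ℂ] H) : H →ₗ[ℂ] H) ≤ (k : Cardinal) := by
  let E : Submodule ℂ H := LinearMap.range (R : H →ₗ[ℂ] H)
  have hE : Module.Finite ℂ E :=
    Module.rank_lt_aleph0_iff.mp (hR.trans_lt (Cardinal.natCast_lt_aleph0))
  have h1 : E.starProjection * R = R := by
    ext x
    exact Submodule.starProjection_eq_self_iff.mpr ⟨x, rfl⟩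
  have h2 : star R = star R * E.starProjection := by
    conv_lhs => rw [← h1, star_mul, (isSelfAdjoint_starProjection E).star_eq]
  rw [h2]
  refine (LinearMap.rank_comp_le_right _ _).trans (le_trans (le_of_eq ?_) hR)
  rw [LinearMap.rank, Submodule.range_starProjection]

theorem singVal_star_le (T : H →L[ℂ] H) (k : ℕ) : singVal (star T) k ≤ singVal T k := by
  refine le_of_forall_gt_imp_ge_of_dense fun c hc => ?_
  obtain ⟨R, hR, h⟩ := exists_rank_le_norm_sub_lt hc
  refine (singVal_le (rank_adjoint_le hR)).trans ?_
  rw [← star_sub, norm_star]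
  exact h.le

theorem singVal_star (T : H →L[ℂ] H) (k : ℕ) : singVal (star T) k = singVal T k :=
  le_antisymm (singVal_star_le T k) (by simpa using singVal_star_le (star T) k)

/-- Let `R` be a finite-rank approximation of `T` with kernel `K`. Cutting `S` down to `Kᗮ`, on
which `R` is injective, gives an operator of no larger rank; the remainder lives on `K`, where `T`
coincides with `T - R`. Applied to `T` and `|T|` in both directions, this replaces the polar
decomposition. -/
theorem singVal_le_of_norm_apply_le {S T : H →L[ℂ] H} (h : ∀ x, ‖S x‖ ≤ ‖T x‖) (k : ℕ) :
    singVal S k ≤ singVal T k := by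
  refine le_of_forall_gt_imp_ge_of_dense fun c hc => ?_
  obtain ⟨R, hR, hc⟩ := exists_rank_le_norm_sub_lt hc
  let K : Submodule ℂ H := LinearMap.ker (R : H →ₗ[ℂ] H)
  have : CompleteSpace K := R.isClosed_ker.completeSpace_coe
  have hrank : LinearMap.rank ((S * Kᗮ.starProjection : H →L[ℂ] H) : H →ₗ[ℂ] H) ≤
      (k : Cardinal) := by
    refine (LinearMap.rank_comp_le_right _ _).trans (le_trans ?_ hR)
    rw [LinearMap.rank, Submodule.range_starProjection]
    refine LinearMap.rank_le_of_injective
      (((R : H →ₗ[ℂ] H).comp Kᗮ.subtype).codRestrict (LinearMap.range (R : H →ₗ[ℂ] H))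
        fun x => ⟨x, rfl⟩) ?_
    rw [← LinearMap.ker_eq_bot, LinearMap.ker_eq_bot']
    intro x hx
    have hx' : R (x : H) = 0 := congrArg Subtype.val hx
    have := Submodule.inner_right_of_mem_orthogonal (K := K) (u := (x : H)) hx' x.2
    exact Subtype.ext (inner_self_eq_zero.mp this)
  refine (singVal_le hrank).trans (le_trans ?_ hc.le)
  refine ContinuousLinearMap.opNorm_le_bound _ (norm_nonneg _) fun x => ?_
  have e : (S - S * Kᗮ.starProjection) x = S (K.starProjection x) := by
    rw [Submodule.starProjection_orthogonal']
    simp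
  have hK : R (K.starProjection x) = 0 := K.starProjection_apply_mem x
  calc ‖(S - S * Kᗮ.starProjection) x‖ ≤ ‖T (K.starProjection x)‖ := by rw [e]; exact h _
    _ = ‖(T - R) (K.starProjection x)‖ := by simp [hK]
    _ ≤ ‖T - R‖ * ‖K.starProjection x‖ := ContinuousLinearMap.le_opNorm _ _
    _ ≤ ‖T - R‖ * ‖x‖ := by gcongr; exact K.norm_starProjection_apply_le x

theorem norm_cfcAbs_apply (T : H →L[ℂ] H) (x : H) : ‖CFC.abs T x‖ = ‖T x‖ := by
  have hs : IsSelfAdjoint (CFC.abs T) := IsSelfAdjoint.of_nonneg (CFC.abs_nonneg T)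
  have h : star (CFC.abs T) * CFC.abs T = star T * T := by rw [hs.star_eq, CFC.abs_mul_abs]
  have key : ∀ S : H →L[ℂ] H, ⟪S x, S x⟫_ℂ = ⟪x, (star S * S) x⟫_ℂ := fun S =>
    (ContinuousLinearMap.adjoint_inner_right S x (S x)).symm
  have := (key (CFC.abs T)).trans ((congrArg (fun S : H →L[ℂ] H => ⟪x, S x⟫_ℂ) h).trans (key T).symm)
  rw [inner_self_eq_norm_sq_to_K, inner_self_eq_norm_sq_to_K] at this
  exact (pow_left_inj₀ (norm_nonneg _) (norm_nonneg _) two_ne_zero).mp (by exact_mod_cast this)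

theorem singVal_cfcAbs (T : H →L[ℂ] H) (k : ℕ) : singVal (CFC.abs T) k = singVal T k :=
  le_antisymm (singVal_le_of_norm_apply_le (fun x => (norm_cfcAbs_apply T x).le) k)
    (singVal_le_of_norm_apply_le (fun x => (norm_cfcAbs_apply T x).ge) k)

theorem singSum_star (T : H →L[ℂ] H) (N : ℕ) : singSum (star T) N = singSum T N := by
  simp [singSum, singVal_star]

theorem singSum_cfcAbs (T : H →L[ℂ] H) (N : ℕ) : singSum (CFC.abs T) N = singSum T N := by
  simp [singSum, singVal_cfcAbs]

end SingularValues

/-! ## Ky Fan's variational inequalities -/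

section KyFan

variable {H : Type*} [NormedAddCommGroup H] [InnerProductSpace ℂ H]

/-- Both sides are the trace of the compression of `T` to `E`. -/
theorem sum_inner_apply_eq_of_orthonormalBasis {ι ι' : Type*} [Fintype ι] [Fintype ι']
    {E : Submodule ℂ H} [FiniteDimensional ℂ E] (b : OrthonormalBasis ι ℂ E)
    (b' : OrthonormalBasis ι' ℂ E) (T : H →L[ℂ] H) :
    ∑ i, ⟪(b i : H), T (b i)⟫_ℂ = ∑ i, ⟪(b' i : H), T (b' i)⟫_ℂ := by
  let S : E →ₗ[ℂ] E := (E.orthogonalProjectionOnto : H →ₗ[ℂ] E) ∘ₗ (T : H →ₗ[ℂ] H) ∘ₗ E.subtype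
  have key : ∀ x : E, ⟪x, S x⟫_ℂ = ⟪(x : H), T x⟫_ℂ := fun x =>
    E.inner_orthogonalProjectionOnto_eq_of_mem_left x (T x)
  simp only [← key]
  rw [← LinearMap.trace_eq_sum_inner, ← LinearMap.trace_eq_sum_inner]

theorem exists_orthonormalBasis_span {ι : Type*} [Fintype ι] {v : ι → H} (hv : Orthonormal ℂ v) :
    ∃ b : OrthonormalBasis ι ℂ (Submodule.span ℂ (Set.range v)), ∀ i, (b i : H) = v i := by
  have hb := orthonormal_span hv
  refine ⟨OrthonormalBasis.mk hb ?_, fun i => by rw [OrthonormalBasis.coe_mk]⟩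
  rw [← Submodule.map_le_map_iff_of_injective (Submodule.span ℂ (Set.range v)).injective_subtype,
    Submodule.map_span, ← Set.range_comp]
  simp [Function.comp_def]

theorem exists_norm_eq_one_of_rank_lt {E : Submodule ℂ H} [FiniteDimensional ℂ E] {N : ℕ}
    (hE : Module.finrank ℂ E = N + 1) {R : H →L[ℂ] H}
    (hR : LinearMap.rank (R : H →ₗ[ℂ] H) ≤ (N : Cardinal)) :
    ∃ x : E, ‖x‖ = 1 ∧ R x = 0 := by
  have hker : LinearMap.ker ((R : H →ₗ[ℂ] H).domRestrict E) ≠ ⊥ := by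
    intro h
    have h1 : LinearMap.rank ((R : H →ₗ[ℂ] H).domRestrict E) ≤ (N : Cardinal) :=
      (LinearMap.rank_comp_le_left E.subtype (R : H →ₗ[ℂ] H)).trans hR
    rw [LinearMap.rank, rank_range_of_injective _ (LinearMap.ker_eq_bot.mp h), ← Module.finrank_eq_rank, hE] at h1
    exact absurd (Nat.cast_le.mp h1) (by omega)
  obtain ⟨y, hy, hy0⟩ := Submodule.exists_mem_ne_zero_of_ne_bot hker
  refine ⟨(‖y‖⁻¹ : ℂ) • y, ?_, ?_⟩
  · simpa using norm_smul_inv_norm (𝕜 := ℂ) hy0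
  · have : R (y : H) = 0 := hy
    simp [this]

/-- The sum of the diagonal coefficients of an operator along `N` orthonormal vectors is at most
`σ_N`. -/
theorem sum_re_inner_apply_le_singSum (T : H →L[ℂ] H) {N : ℕ} {v : Fin N → H}
    (hv : Orthonormal ℂ v) : ∑ i, (⟪v i, T (v i)⟫_ℂ).re ≤ singSum T N := by
  suffices h : ∀ δ > 0, ∑ i, (⟪v i, T (v i)⟫_ℂ).re ≤ singSum T N + N * δ by
    refine le_of_forall_pos_le_add fun ε hε => (h (ε / (N + 1)) (by positivity)).trans ?_
    gcongr
    rw [← mul_div_assoc, div_le_iff₀ (by positivity)]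
    nlinarith
  intro δ hδ
  induction N with
  | zero => simp [singSum]
  | succ N ih =>
    let E := Submodule.span ℂ (Set.range v)
    obtain ⟨b, hb⟩ : ∃ b : OrthonormalBasis (Fin (N + 1)) ℂ E, ∀ i, (b i : H) = v i :=
      exists_orthonormalBasis_span hv
    have : FiniteDimensional ℂ E := FiniteDimensional.span_of_finite ℂ (Set.finite_range v)
    have hE : Module.finrank ℂ E = N + 1 := by
      simpa using Module.finrank_eq_card_basis b.toBasis
    -- A nearly optimal `R` of rank at most `N` kills a unit vector `x` of the `(N + 1)`-dimensional
    -- span, so the coefficient of `T` at `x` is that of `T - R`, below `μ_N + δ`. As the sum is a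
    -- trace, the basis may be changed to one containing `x`; the other `N` vectors fall to the
    -- induction.
    obtain ⟨R, hR, hlt⟩ := exists_rank_le_norm_sub_lt (T := T) (k := N)
      (lt_add_of_pos_right _ hδ)
    obtain ⟨x, hx1, hx⟩ := exists_norm_eq_one_of_rank_lt hE hR
    obtain ⟨c, hc⟩ := Orthonormal.exists_orthonormalBasis_extension_of_card_eq
      (𝕜 := ℂ) (E := E) (ι := Fin (N + 1)) (by simpa using hE) (v := fun _ => x)
      (s := {Fin.last N}) (by
        rw [orthonormal_iff_ite]
        rintro ⟨i, hi⟩ ⟨j, hj⟩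
        obtain rfl : i = Fin.last N := hi
        obtain rfl : j = Fin.last N := hj
        simp [inner_self_eq_norm_sq_to_K, hx1])
    have hcx : c (Fin.last N) = x := hc _ rfl
    have e : ∑ i, (⟪v i, T (v i)⟫_ℂ).re = ∑ i, (⟪(c i : H), T (c i)⟫_ℂ).re := by
      rw [← Complex.re_sum, ← Complex.re_sum, ← sum_inner_apply_eq_of_orthonormalBasis b c]
      simp only [hb]
    have hc' : Orthonormal ℂ fun i => (c i : H) := c.orthonormal.comp_linearIsometry E.subtypeₗᵢ
    have h1 := ih (v := fun i => (c i.castSucc : H)) (hc'.comp _ (Fin.castSucc_injective N))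
    have h2 : (⟪(x : H), T x⟫_ℂ).re ≤ singVal T N + δ := by
      have : T x = (T - R) x := by simp [hx]
      rw [this]
      refine (Complex.re_le_norm _).trans ((norm_inner_le_norm _ _).trans ?_)
      have hx1' : ‖(x : H)‖ = 1 := hx1
      rw [hx1', one_mul]
      exact ((T - R).le_opNorm x).trans (by rw [hx1', mul_one]; exact hlt.le)
    rw [e, Fin.sum_univ_castSucc, hcx, singSum, Finset.sum_range_succ]
    rw [singSum] at h1
    push_cast
    linarith

theorem re_inner_apply_nonneg {T : H →L[ℂ] H} (hT : 0 ≤ T) (x : H) : 0 ≤ (⟪x, T x⟫_ℂ).re :=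
  ((ContinuousLinearMap.nonneg_iff_isPositive T).mp hT).re_inner_nonneg_right x

/-- The family extends to an orthonormal basis of `E`, and the added diagonal coefficients are
nonnegative. -/
theorem sum_re_inner_apply_le_of_mem {T : H →L[ℂ] H} (hT : 0 ≤ T) {ι ι' : Type*} [Fintype ι]
    [Fintype ι'] {E : Submodule ℂ H} [FiniteDimensional ℂ E] (b : OrthonormalBasis ι' ℂ E)
    {v : ι → H} (hv : Orthonormal ℂ v) (hvE : ∀ i, v i ∈ E) :
    ∑ i, (⟪v i, T (v i)⟫_ℂ).re ≤ ∑ i, (⟪(b i : H), T (b i)⟫_ℂ).re := by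
  classical
  let w : ι → E := fun i => ⟨v i, hvE i⟩
  have hw : Orthonormal ℂ w := by
    rw [← E.subtypeₗᵢ.orthonormal_comp_iff]
    exact hv
  obtain ⟨u, c, hu, hc⟩ := hw.toSubtypeRange.exists_orthonormalBasis_extension
  have e : ∑ i, (⟪(b i : H), T (b i)⟫_ℂ).re = ∑ x ∈ u, (⟪(x : H), T x⟫_ℂ).re := by
    rw [← Complex.re_sum, ← Complex.re_sum, sum_inner_apply_eq_of_orthonormalBasis b c, hc]
    exact congrArg Complex.re (Finset.sum_coe_sort u fun x : E => ⟪(x : H), T x⟫_ℂ)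
  have e' : ∑ i, (⟪v i, T (v i)⟫_ℂ).re = ∑ x ∈ Finset.univ.image w, (⟪(x : H), T x⟫_ℂ).re := by
    rw [Finset.sum_image hw.linearIndependent.injective.injOn]
  rw [e, e']
  refine Finset.sum_le_sum_of_subset_of_nonneg ?_ fun x _ _ => re_inner_apply_nonneg hT x
  intro x hx
  obtain ⟨i, -, rfl⟩ := Finset.mem_image.mp hx
  exact hu ⟨i, rfl⟩

variable [CompleteSpace H]

theorem re_inner_apply_eq_norm_sqrt_sq {T : H →L[ℂ] H} (hT : 0 ≤ T) (x : H) :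
    (⟪x, T x⟫_ℂ).re = ‖CFC.sqrt T x‖ ^ 2 := by
  have hs : IsSelfAdjoint (CFC.sqrt T) := IsSelfAdjoint.of_nonneg (CFC.sqrt_nonneg T)
  have h : T x = CFC.sqrt T (CFC.sqrt T x) :=
    congrArg (fun S : H →L[ℂ] H => S x) (CFC.sqrt_mul_sqrt_self T hT).symm
  have h' := ContinuousLinearMap.isSelfAdjoint_iff_isSymmetric.mp hs x (CFC.sqrt T x)
  rw [h]
  have h'' : ⟪CFC.sqrt T x, CFC.sqrt T x⟫_ℂ = ⟪x, CFC.sqrt T (CFC.sqrt T x)⟫_ℂ := h'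
  rw [← h'', inner_self_eq_norm_sq_to_K]
  norm_cast

/-- Subtracting `√T P √T`, with `P` the projection onto `E`, leaves `X X*` for `X = √T (1 - P)`. -/
theorem singVal_le_norm_sqrt_mul_sq {T : H →L[ℂ] H} (hT : 0 ≤ T) {E : Submodule ℂ H}
    [FiniteDimensional ℂ E] {k : ℕ} (hE : Module.finrank ℂ E ≤ k) :
    singVal T k ≤ ‖CFC.sqrt T * Eᗮ.starProjection‖ ^ 2 := by
  set S := CFC.sqrt T
  have hS : star S = S := (IsSelfAdjoint.of_nonneg (CFC.sqrt_nonneg T)).star_eq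
  have hP : star Eᗮ.starProjection = Eᗮ.starProjection := (isSelfAdjoint_starProjection _).star_eq
  have hrank : LinearMap.rank ((S * (E.starProjection * S) : H →L[ℂ] H) : H →ₗ[ℂ] H) ≤
      (k : Cardinal) := by
    refine (LinearMap.rank_comp_le_right _ _).trans ((LinearMap.rank_comp_le_left _ _).trans ?_)
    rw [LinearMap.rank, Submodule.range_starProjection, ← Module.finrank_eq_rank]
    exact_mod_cast hE
  refine (singVal_le hrank).trans (le_of_eq ?_)
  have hPP : Eᗮ.starProjection * Eᗮ.starProjection = Eᗮ.starProjection :=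
    Eᗮ.isIdempotentElem_starProjection
  have e : T - S * (E.starProjection * S) =
      (S * Eᗮ.starProjection) * star (S * Eᗮ.starProjection) := by
    rw [star_mul, hS, hP, mul_assoc, ← mul_assoc Eᗮ.starProjection, hPP,
      Submodule.starProjection_orthogonal', sub_mul, mul_sub, one_mul,
      CFC.sqrt_mul_sqrt_self T hT]
  rw [e, CStarRing.norm_self_mul_star, sq]

theorem exists_orthogonal_re_inner_apply_ge {T : H →L[ℂ] H} (hT : 0 ≤ T) {E : Submodule ℂ H}
    [FiniteDimensional ℂ E] {k : ℕ} (hE : Module.finrank ℂ E ≤ k) {c : ℝ} (hc : 0 ≤ c)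
    (hck : c < singVal T k) : ∃ x ∈ Eᗮ, ‖x‖ = 1 ∧ c ≤ (⟪x, T x⟫_ℂ).re := by
  have h1 : √c < ‖CFC.sqrt T * Eᗮ.starProjection‖ := by
    rw [Real.sqrt_lt' (lt_of_le_of_ne (norm_nonneg _) ?_)]
    · exact hck.trans_le (singVal_le_norm_sqrt_mul_sq hT hE)
    · intro h0
      have := singVal_le_norm_sqrt_mul_sq hT hE
      rw [← h0] at this
      norm_num at this
      linarith
  obtain ⟨y, hy⟩ : ∃ y, √c * ‖y‖ < ‖CFC.sqrt T (Eᗮ.starProjection y)‖ := by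
    by_contra! h
    exact absurd (ContinuousLinearMap.opNorm_le_bound _ (Real.sqrt_nonneg c) h) (not_le.mpr h1)
  set z := Eᗮ.starProjection y
  have hzE : z ∈ Eᗮ := Eᗮ.starProjection_apply_mem y
  have hz0 : z ≠ 0 := by
    intro h
    rw [h, map_zero, norm_zero] at hy
    exact absurd hy (not_lt.mpr (by positivity))
  have hzy : ‖z‖ ≤ ‖y‖ := Eᗮ.norm_starProjection_apply_le y
  have hz : √c * ‖z‖ ≤ ‖CFC.sqrt T z‖ :=
    (mul_le_mul_of_nonneg_left hzy (Real.sqrt_nonneg c)).trans hy.le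
  refine ⟨(‖z‖⁻¹ : ℂ) • z, Submodule.smul_mem _ _ hzE, by
    simpa using norm_smul_inv_norm (𝕜 := ℂ) hz0, ?_⟩
  have hpos : 0 < ‖z‖ := norm_pos_iff.mpr hz0
  rw [re_inner_apply_eq_norm_sqrt_sq hT, map_smul, norm_smul, ← Real.sqrt_le_left (by positivity)]
  rw [norm_inv, Complex.norm_real, norm_norm, le_inv_mul_iff₀ hpos, mul_comm]
  exact hz

/-- Up to `ε`, the sum `σ_N` of a positive operator is attained by the diagonal coefficients along
at most `N` orthonormal vectors. -/
theorem exists_orthonormal_singSum_le {T : H →L[ℂ] H} (hT : 0 ≤ T) (N : ℕ) {ε : ℝ} (hε : 0 < ε) :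
    ∃ (m : ℕ) (v : Fin m → H), m ≤ N ∧ Orthonormal ℂ v ∧
      singSum T N ≤ ∑ i, (⟪v i, T (v i)⟫_ℂ).re + N * ε := by
  induction N with
  | zero => exact ⟨0, Fin.elim0, le_rfl, by simp [Orthonormal, Pairwise], by simp [singSum]⟩
  | succ N ih =>
    obtain ⟨m, v, hm, hv, h⟩ := ih
    rw [singSum] at h
    by_cases hc : singVal T N ≤ ε
    -- A singular value at most `ε` is absorbed by the error without a new vector; there may be no
    -- room for one when `H` is finite-dimensional.
    · refine ⟨m, v, hm.trans N.le_succ, hv, ?_⟩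
      rw [singSum, Finset.sum_range_succ]
      push_cast
      linarith
    · push Not at hc
      have : FiniteDimensional ℂ (Submodule.span ℂ (Set.range v)) :=
        FiniteDimensional.span_of_finite ℂ (Set.finite_range v)
      obtain ⟨x, hxE, hx1, hx⟩ := exists_orthogonal_re_inner_apply_ge hT
        (E := Submodule.span ℂ (Set.range v)) (k := N)
        ((finrank_range_le_card v).trans (by simpa using hm)) (sub_nonneg.mpr hc.le)
        (sub_lt_self _ hε)
      refine ⟨m + 1, Matrix.vecCons x v, by omega, ?_, ?_⟩
      · rw [orthonormal_vecCons_iff]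
        exact ⟨hx1, fun i => Submodule.inner_left_of_mem_orthogonal
          (Submodule.subset_span (Set.mem_range_self i)) hxE, hv⟩
      · rw [singSum, Finset.sum_range_succ, Fin.sum_univ_succ]
        simp only [Matrix.cons_val_zero, Matrix.cons_val_succ]
        push_cast
        linarith

theorem singSum_le_of_forall_orthonormal {T : H →L[ℂ] H} (hT : 0 ≤ T) {N : ℕ} {c : ℝ}
    (h : ∀ (m : ℕ) (v : Fin m → H), m ≤ N → Orthonormal ℂ v →
      ∑ i, (⟪v i, T (v i)⟫_ℂ).re ≤ c) : singSum T N ≤ c := by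
  refine le_of_forall_pos_le_add fun ε hε => ?_
  obtain ⟨m, v, hm, hv, h1⟩ := exists_orthonormal_singSum_le hT N
    (ε := ε / (N + 1)) (by positivity)
  refine h1.trans (add_le_add (h m v hm hv) ?_)
  rw [← mul_div_assoc, div_le_iff₀ (by positivity)]
  nlinarith

theorem singSum_add_le {S T : H →L[ℂ] H} (hS : 0 ≤ S) (hT : 0 ≤ T) (N : ℕ) :
    singSum (S + T) N ≤ singSum S N + singSum T N := by
  refine singSum_le_of_forall_orthonormal (add_nonneg hS hT) fun m v hm hv => ?_
  simp only [add_apply, inner_add_right, Complex.add_re,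
    Finset.sum_add_distrib]
  exact add_le_add ((sum_re_inner_apply_le_singSum S hv).trans (singSum_mono S hm))
    ((sum_re_inner_apply_le_singSum T hv).trans (singSum_mono T hm))

/-- Two families of at most `N` vectors, one for `S` and one for `T`, span a space of dimension at
most `2N`. By positivity, the trace over this space dominates the sum along each family. -/
theorem singSum_add_singSum_le {S T : H →L[ℂ] H} (hS : 0 ≤ S) (hT : 0 ≤ T) (N : ℕ) :
    singSum S N + singSum T N ≤ singSum (S + T) (2 * N) := by
  rw [← le_sub_iff_add_le]
  refine singSum_le_of_forall_orthonormal hS fun m v hm hv => ?_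
  rw [le_sub_comm]
  refine singSum_le_of_forall_orthonormal hT fun m' w hm' hw => ?_
  rw [le_sub_iff_add_le, add_comm]
  let E := Submodule.span ℂ (Set.range (Sum.elim v w))
  have : FiniteDimensional ℂ E := FiniteDimensional.span_of_finite ℂ (Set.finite_range _)
  let b := stdOrthonormalBasis ℂ E
  have hE : Module.finrank ℂ E ≤ 2 * N :=
    (finrank_range_le_card (Sum.elim v w)).trans (by simp; omega)
  have hb : Orthonormal ℂ fun i => (b i : H) := b.orthonormal.comp_linearIsometry E.subtypeₗᵢ
  have h1 := sum_re_inner_apply_le_of_mem hS b hv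
    fun i => Submodule.subset_span ⟨Sum.inl i, rfl⟩
  have h2 := sum_re_inner_apply_le_of_mem hT b hw
    fun i => Submodule.subset_span ⟨Sum.inr i, rfl⟩
  refine (add_le_add h1 h2).trans (le_trans (le_of_eq ?_)
    ((sum_re_inner_apply_le_singSum (S + T) hb).trans (singSum_mono _ hE)))
  simp only [add_apply, inner_add_right, Complex.add_re,
    Finset.sum_add_distrib]

end KyFan

/-! ## Limiting procedures on bounded sequences -/

namespace DixmierLimit

variable (ω : DixmierLimit)

/-- The value does not depend on the bound chosen in the definition. -/
theorem ofSeq_eq {α : ℕ → ℝ} {C : ℝ} (h : ∀ k, ‖α k‖ ≤ C) :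
    ω.ofSeq α = ω.lim (BoundedContinuousFunction.ofNormedAddCommGroupDiscrete α C h) := by
  rw [ofSeq, dif_pos ⟨C, h⟩]
  rfl

theorem ofSeq_add {α β : ℕ → ℝ} (hα : ∃ C : ℝ, ∀ k, ‖α k‖ ≤ C) (hβ : ∃ C : ℝ, ∀ k, ‖β k‖ ≤ C) :
    ω.ofSeq (fun k => α k + β k) = ω.ofSeq α + ω.ofSeq β := by
  obtain ⟨C, hC⟩ := hα
  obtain ⟨C', hC'⟩ := hβ
  rw [ω.ofSeq_eq hC, ω.ofSeq_eq hC', ← map_add,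
    ω.ofSeq_eq (C := C + C') fun k => (norm_add_le _ _).trans (add_le_add (hC k) (hC' k))]
  rfl

theorem ofSeq_const_mul {α : ℕ → ℝ} (hα : ∃ C : ℝ, ∀ k, ‖α k‖ ≤ C) (c : ℝ) :
    ω.ofSeq (fun k => c * α k) = c * ω.ofSeq α := by
  obtain ⟨C, hC⟩ := hα
  rw [ω.ofSeq_eq hC, ← smul_eq_mul c (ω.lim _), ← map_smul, ω.ofSeq_eq (C := ‖c‖ * C) fun k => by
    rw [norm_mul]; exact mul_le_mul_of_nonneg_left (hC k) (norm_nonneg c)]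
  rfl

theorem ofSeq_mono {α β : ℕ → ℝ} (hα : ∃ C : ℝ, ∀ k, ‖α k‖ ≤ C) (hβ : ∃ C : ℝ, ∀ k, ‖β k‖ ≤ C)
    (h : ∀ k, α k ≤ β k) : ω.ofSeq α ≤ ω.ofSeq β := by
  obtain ⟨C, hC⟩ := hα
  obtain ⟨C', hC'⟩ := hβ
  rw [ω.ofSeq_eq hC, ω.ofSeq_eq hC', ← sub_nonneg, ← map_sub]
  exact ω.nonneg _ fun k => sub_nonneg.mpr (h k)

theorem exists_norm_le_of_tendsto {α : ℕ → ℝ} {l : ℝ} (h : Tendsto α atTop (𝓝 l)) :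
    ∃ C : ℝ, ∀ k, ‖α k‖ ≤ C := by
  obtain ⟨C, hC⟩ := (Metric.isBounded_range_of_tendsto α h).exists_norm_le
  exact ⟨C, fun k => hC _ ⟨k, rfl⟩⟩

theorem ofSeq_of_tendsto {α : ℕ → ℝ} {l : ℝ} (h : Tendsto α atTop (𝓝 l)) : ω.ofSeq α = l := by
  obtain ⟨C, hC⟩ := exists_norm_le_of_tendsto h
  rw [ω.ofSeq_eq hC]
  exact ω.of_tendsto _ l h

theorem ofSeq_comp_div_two {α : ℕ → ℝ} (hα : ∃ C : ℝ, ∀ k, ‖α k‖ ≤ C) :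
    ω.ofSeq (fun k => α (k / 2)) = ω.ofSeq α := by
  obtain ⟨C, hC⟩ := hα
  rw [ω.ofSeq_eq hC, ← ω.double, ω.ofSeq_eq fun k => hC (k / 2)]
  rfl

end DixmierLimit

/-! ## The ideal `𝓛^{1,∞}` -/

section WeakSchatten

variable {H : Type*} [NormedAddCommGroup H] [InnerProductSpace ℂ H]

theorem memWeakSchatten_one_iff {T : H →L[ℂ] H} :
    MemWeakSchatten 1 T ↔ ∃ C : ℝ, ∀ N : ℕ, 2 ≤ N → singSum T N ≤ C * Real.log N := by
  simp [MemWeakSchatten]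

theorem MemWeakSchatten.of_singSum_le {p : ℕ} {S T : H →L[ℂ] H} (hT : MemWeakSchatten p T) {c : ℝ}
    (hc : 0 ≤ c) (h : ∀ N, singSum S N ≤ c * singSum T N) : MemWeakSchatten p S := by
  obtain ⟨C, hC⟩ := hT
  refine ⟨c * C, fun N hN => (h N).trans ?_⟩
  rw [mul_assoc]
  exact mul_le_mul_of_nonneg_left (hC N hN) hc

theorem MemWeakSchatten.add {p : ℕ} {S T : H →L[ℂ] H} (hS : MemWeakSchatten p S)
    (hT : MemWeakSchatten p T) : MemWeakSchatten p (S + T) := by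
  obtain ⟨C, hC⟩ := hS
  obtain ⟨C', hC'⟩ := hT
  refine ⟨2 * C + 2 * C', fun N hN => (singSum_add_le_two_mul S T N).trans ?_⟩
  linarith [hC N hN, hC' N hN]

theorem MemWeakSchatten.smul {p : ℕ} {T : H →L[ℂ] H} (hT : MemWeakSchatten p T) (c : ℂ) :
    MemWeakSchatten p (c • T) :=
  hT.of_singSum_le (norm_nonneg c) fun N => (singSum_smul c T N).le

theorem MemWeakSchatten.mul_left {p : ℕ} {T : H →L[ℂ] H} (hT : MemWeakSchatten p T)
    (A : H →L[ℂ] H) : MemWeakSchatten p (A * T) :=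
  hT.of_singSum_le (norm_nonneg A) fun N => singSum_mul_le_norm_mul A T N

theorem MemWeakSchatten.mul_right {p : ℕ} {T : H →L[ℂ] H} (hT : MemWeakSchatten p T)
    (A : H →L[ℂ] H) : MemWeakSchatten p (T * A) :=
  hT.of_singSum_le (norm_nonneg A) fun N => by
    rw [mul_comm]; exact singSum_mul_le_mul_norm T A N

theorem exists_norm_singSum_div_log_le {T : H →L[ℂ] H} (hT : MemWeakSchatten 1 T) :
    ∃ C : ℝ, ∀ N : ℕ, ‖singSum T N / Real.log N‖ ≤ C := by
  obtain ⟨C, hC⟩ := memWeakSchatten_one_iff.mp hT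
  refine ⟨max C 0, fun N => ?_⟩
  rw [Real.norm_of_nonneg (div_nonneg (singSum_nonneg T N) (Real.log_natCast_nonneg N))]
  rcases lt_or_ge N 2 with hN | hN
  · interval_cases N <;> simp
  · have : 0 < Real.log N := Real.log_pos (by exact_mod_cast hN)
    exact ((div_le_iff₀ this).mpr (hC N hN)).trans (le_max_left _ _)

variable [CompleteSpace H]

theorem singSum_realPart_le (T : H →L[ℂ] H) (N : ℕ) :
    singSum (ℜ T : H →L[ℂ] H) N ≤ 2 * singSum T N := by
  have h : (ℜ T : H →L[ℂ] H) = ((2 : ℂ)⁻¹) • (T + star T) := by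
    rw [realPart_apply_coe, ← Complex.coe_smul]
    norm_num
  have := singSum_add_le_two_mul T (star T) N
  rw [singSum_star] at this
  rw [h, singSum_smul]
  norm_num
  linarith

theorem singSum_imaginaryPart_le (T : H →L[ℂ] H) (N : ℕ) :
    singSum (ℑ T : H →L[ℂ] H) N ≤ 2 * singSum T N := by
  have h : ℑ T = ℜ ((-Complex.I) • T) := by
    rw [neg_smul, map_neg, realPart_I_smul, neg_neg]
  rw [h]
  refine (singSum_realPart_le _ N).trans (le_of_eq ?_)
  rw [singSum_smul]
  simp

/-- Here `2 S⁺ = |S| + S`, and `|S|` has the singular values of `S`. -/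
theorem singSum_posPart_le {S : H →L[ℂ] H} (hS : IsSelfAdjoint S) (N : ℕ) :
    singSum S⁺ N ≤ 2 * singSum S N := by
  have h := singSum_smul (2 : ℂ) S⁺ N
  have e : (2 : ℂ) • S⁺ = CFC.abs S + S := by
    rw [CFC.abs_add_self S hS, ← Nat.cast_smul_eq_nsmul ℂ, Nat.cast_ofNat]
  have := singSum_add_le_two_mul (CFC.abs S) S N
  rw [e] at h
  rw [h, singSum_cfcAbs] at this
  norm_num at this
  linarith

theorem singSum_negPart_le {S : H →L[ℂ] H} (hS : IsSelfAdjoint S) (N : ℕ) :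
    singSum S⁻ N ≤ 2 * singSum S N := by
  have := singSum_posPart_le hS.neg N
  rwa [CFC.posPart_neg, singSum_neg] at this

theorem MemWeakSchatten.posPart {p : ℕ} {S : H →L[ℂ] H} (h : MemWeakSchatten p S)
    (hS : IsSelfAdjoint S) : MemWeakSchatten p S⁺ :=
  h.of_singSum_le zero_le_two (singSum_posPart_le hS)

theorem MemWeakSchatten.negPart {p : ℕ} {S : H →L[ℂ] H} (h : MemWeakSchatten p S)
    (hS : IsSelfAdjoint S) : MemWeakSchatten p S⁻ :=
  h.of_singSum_le zero_le_two (singSum_negPart_le hS)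

theorem MemWeakSchatten.realPart {p : ℕ} {T : H →L[ℂ] H} (h : MemWeakSchatten p T) :
    MemWeakSchatten p (ℜ T : H →L[ℂ] H) :=
  h.of_singSum_le zero_le_two (singSum_realPart_le T)

theorem MemWeakSchatten.imaginaryPart {p : ℕ} {T : H →L[ℂ] H} (h : MemWeakSchatten p T) :
    MemWeakSchatten p (ℑ T : H →L[ℂ] H) :=
  h.of_singSum_le zero_le_two (singSum_imaginaryPart_le T)

theorem singSum_unitary_conj {U : H →L[ℂ] H} (hU : U ∈ unitary (H →L[ℂ] H)) (T : H →L[ℂ] H)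
    (N : ℕ) : singSum (U * T * star U) N = singSum T N := by
  have key : ∀ V ∈ unitary (H →L[ℂ] H), ∀ S : H →L[ℂ] H,
      singSum (V * S * star V) N ≤ singSum S N := by
    intro V hV S
    have h1 : ‖V‖ ≤ 1 := by
      have : ‖V‖ * ‖V‖ ≤ 1 := by
        rw [← CStarRing.norm_star_mul_self, Unitary.star_mul_self_of_mem hV]
        exact ContinuousLinearMap.norm_id_le
      nlinarith [norm_nonneg V]
    have h2 := (singSum_mul_le_mul_norm (V * S) (star V) N)
    have h3 := singSum_mul_le_norm_mul V S N
    rw [norm_star] at h2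
    have := singSum_nonneg (V * S) N
    have := singSum_nonneg S N
    nlinarith
  refine le_antisymm (key U hU T) ?_
  have := key (star U) (Unitary.star_mem hU) (U * T * star U)
  have e : star U * (U * T * star U) * star (star U) = T := by
    rw [star_star, mul_assoc U, ← mul_assoc, Unitary.star_mul_self_of_mem hU, one_mul, mul_assoc,
      Unitary.star_mul_self_of_mem hU, mul_one]
  rwa [e] at this

end WeakSchatten

/-! ## Dixmier traces -/

namespace DixmierLimit

variable {H : Type*} [NormedAddCommGroup H] [InnerProductSpace ℂ H]
variable (ω : DixmierLimit)

theorem tracePos_smul {T : H →L[ℂ] H} (hT : MemWeakSchatten 1 T) {c : ℝ} (hc : 0 ≤ c) :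
    ω.tracePos ((c : ℂ) • T) = c * ω.tracePos T := by
  rw [tracePos, tracePos, ← ω.ofSeq_const_mul (exists_norm_singSum_div_log_le hT)]
  congr 1
  funext N
  rw [singSum_smul, Complex.norm_real, Real.norm_of_nonneg hc, mul_div_assoc]

theorem tracePos_eq_zero {T : H →L[ℂ] H} {C : ℝ} (hT : ∀ N, singSum T N ≤ C) :
    ω.tracePos T = 0 := by
  refine ω.ofSeq_of_tendsto ?_
  refine squeeze_zero (fun N => div_nonneg (singSum_nonneg T N) (Real.log_natCast_nonneg N))
    (fun N => div_le_div_of_nonneg_right (hT N) (Real.log_natCast_nonneg N)) ?_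
  exact (Real.tendsto_log_atTop.comp tendsto_natCast_atTop_atTop).const_div_atTop C

/-- Doubling invariance replaces the index `N` by `k / 2`. Then `2 (k / 2) ≤ k`, and passing from
`log (k / 2)` to `log k` in the denominator costs `O(1 / log (k / 2))`, which tends to `0`. -/
theorem ofSeq_singSum_two_mul_le {T : H →L[ℂ] H} (hT : MemWeakSchatten 1 T) :
    (∃ C : ℝ, ∀ N : ℕ, ‖singSum T (2 * N) / Real.log N‖ ≤ C) ∧
      ω.ofSeq (fun N => singSum T (2 * N) / Real.log N) ≤ ω.tracePos T := by
  obtain ⟨C, hC⟩ := exists_norm_singSum_div_log_le hT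
  have hC0 : 0 ≤ C := (norm_nonneg _).trans (hC 0)
  have hC' : ∀ N : ℕ, 2 ≤ N → singSum T N ≤ C * Real.log N := fun N hN =>
    (div_le_iff₀ (Real.log_pos (by exact_mod_cast hN))).mp ((Real.le_norm_self _).trans (hC N))
  have hbdd : ∃ C : ℝ, ∀ N : ℕ, ‖singSum T (2 * N) / Real.log N‖ ≤ C := by
    refine ⟨2 * C, fun N => ?_⟩
    rw [Real.norm_of_nonneg (div_nonneg (singSum_nonneg T _) (Real.log_natCast_nonneg N))]
    rcases lt_or_ge N 2 with hN | hN
    · interval_cases N <;> simp [hC0]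
    · have hN' : (2 : ℝ) ≤ N := by exact_mod_cast hN
      rw [div_le_iff₀ (Real.log_pos (by linarith))]
      refine (hC' (2 * N) (by omega)).trans ?_
      push_cast
      rw [Real.log_mul two_ne_zero (by linarith)]
      nlinarith [Real.log_le_log two_pos hN']
  refine ⟨hbdd, ?_⟩
  -- The `3` comes from `k ≤ 3 (k / 2)`, valid for the integer quotient as soon as `k ≥ 2`.
  have hlim : Tendsto (fun k : ℕ => C * Real.log 3 / Real.log ((k / 2 : ℕ) : ℝ)) atTop (𝓝 0) :=
    (Real.tendsto_log_atTop.comp (tendsto_natCast_atTop_atTop.comp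
      (Nat.tendsto_div_const_atTop two_ne_zero))).const_div_atTop _
  rw [← ω.ofSeq_comp_div_two hbdd, ← add_zero (ω.tracePos T), ← ω.ofSeq_of_tendsto hlim,
    tracePos, ← ω.ofSeq_add ⟨C, hC⟩ (exists_norm_le_of_tendsto hlim)]
  obtain ⟨C₁, h₁⟩ := hbdd
  obtain ⟨C₂, h₂⟩ := exists_norm_le_of_tendsto hlim
  refine ω.ofSeq_mono ⟨C₁, fun k => h₁ (k / 2)⟩
    ⟨C + C₂, fun k => (norm_add_le _ _).trans (add_le_add (hC k) (h₂ k))⟩ fun k => ?_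
  rcases lt_or_ge k 4 with hk | hk
  -- For `k < 4` the quotient is `0` or `1`, so both divisions by its logarithm are divisions by
  -- zero, with value `0`.
  · have h0 : Real.log ((k / 2 : ℕ) : ℝ) = 0 := by interval_cases k <;> simp
    rw [h0, div_zero, div_zero, add_zero]
    exact div_nonneg (singSum_nonneg T k) (Real.log_natCast_nonneg k)
  · have hk2 : 0 < Real.log ((k / 2 : ℕ) : ℝ) := Real.log_pos (by
      exact_mod_cast (show 1 < k / 2 by omega))
    have hk0 : 0 < Real.log k := Real.log_pos (by exact_mod_cast (show 1 < k by omega))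
    have hlog : Real.log k ≤ Real.log 3 + Real.log ((k / 2 : ℕ) : ℝ) := by
      have : 0 < k / 2 := by omega
      rw [← Real.log_mul three_ne_zero (by positivity)]
      exact Real.log_le_log (by positivity) (by exact_mod_cast (show k ≤ 3 * (k / 2) by omega))
    have hσ := hC' k (by omega)
    have h0 := singSum_nonneg T k
    refine (div_le_div_of_nonneg_right (singSum_mono T (show 2 * (k / 2) ≤ k by omega))
      hk2.le).trans ?_
    rw [div_add_div _ _ hk0.ne' hk2.ne', div_le_div_iff₀ hk2 (mul_pos hk0 hk2)]
    have : singSum T k * Real.log k ≤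
        singSum T k * Real.log ((k / 2 : ℕ) : ℝ) + Real.log k * (C * Real.log 3) := by
      nlinarith [mul_le_mul_of_nonneg_left hlog h0,
        mul_le_mul_of_nonneg_right hσ (Real.log_nonneg (show (1 : ℝ) ≤ 3 by norm_num))]
    nlinarith

variable [CompleteSpace H]

theorem tracePos_add {S T : H →L[ℂ] H} (hS0 : 0 ≤ S) (hT0 : 0 ≤ T) (hS : MemWeakSchatten 1 S)
    (hT : MemWeakSchatten 1 T) : ω.tracePos (S + T) = ω.tracePos S + ω.tracePos T := by
  have bS := exists_norm_singSum_div_log_le hS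
  have bT := exists_norm_singSum_div_log_le hT
  have b : ∃ C : ℝ, ∀ N : ℕ, ‖singSum S N / Real.log N + singSum T N / Real.log N‖ ≤ C := by
    obtain ⟨C, hC⟩ := bS
    obtain ⟨C', hC'⟩ := bT
    exact ⟨C + C', fun k => (norm_add_le _ _).trans (add_le_add (hC k) (hC' k))⟩
  have e : ω.tracePos S + ω.tracePos T =
      ω.ofSeq fun N => singSum S N / Real.log N + singSum T N / Real.log N :=
    (ω.ofSeq_add bS bT).symm
  obtain ⟨bd, hd⟩ := ω.ofSeq_singSum_two_mul_le (hS.add hT)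
  rw [e]
  apply le_antisymm
  · refine ω.ofSeq_mono (exists_norm_singSum_div_log_le (hS.add hT)) b fun N => ?_
    rw [← add_div]
    exact div_le_div_of_nonneg_right (singSum_add_le hS0 hT0 N) (Real.log_natCast_nonneg N)
  · refine (ω.ofSeq_mono b bd fun N => ?_).trans hd
    rw [← add_div]
    exact div_le_div_of_nonneg_right (singSum_add_singSum_le hS0 hT0 N) (Real.log_natCast_nonneg N)

/-- Additivity on positive operators, applied to `(P - Q)⁺ + Q = P + (P - Q)⁻`, makes the value
independent of the decomposition; linearity follows from this. -/
theorem traceSA_sub_of_nonneg {P Q : H →L[ℂ] H} (hP0 : 0 ≤ P) (hQ0 : 0 ≤ Q)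
    (hP : MemWeakSchatten 1 P) (hQ : MemWeakSchatten 1 Q) :
    ω.traceSA (P - Q) = ω.tracePos P - ω.tracePos Q := by
  have hs : IsSelfAdjoint (P - Q) := (IsSelfAdjoint.of_nonneg hP0).sub (IsSelfAdjoint.of_nonneg hQ0)
  have hm : MemWeakSchatten 1 (P - Q) := by
    simpa [sub_eq_add_neg] using hP.add (hQ.smul (-1))
  have e : (P - Q)⁺ + Q = P + (P - Q)⁻ := by
    have := CFC.posPart_sub_negPart (P - Q) hs
    rw [sub_eq_sub_iff_add_eq_add] at this
    rw [this]
  have h1 := ω.tracePos_add (CFC.posPart_nonneg (P - Q)) hQ0 (hm.posPart hs) hQ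
  have h2 := ω.tracePos_add hP0 (CFC.negPart_nonneg (P - Q)) hP (hm.negPart hs)
  rw [e] at h1
  rw [traceSA]
  linarith

theorem traceSA_add {S T : H →L[ℂ] H} (hSs : IsSelfAdjoint S) (hTs : IsSelfAdjoint T)
    (hS : MemWeakSchatten 1 S) (hT : MemWeakSchatten 1 T) :
    ω.traceSA (S + T) = ω.traceSA S + ω.traceSA T := by
  have e : S + T = (S⁺ + T⁺) - (S⁻ + T⁻) := by
    rw [add_sub_add_comm, CFC.posPart_sub_negPart S hSs, CFC.posPart_sub_negPart T hTs]
  rw [e, ω.traceSA_sub_of_nonneg (add_nonneg (CFC.posPart_nonneg S) (CFC.posPart_nonneg T))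
    (add_nonneg (CFC.negPart_nonneg S) (CFC.negPart_nonneg T))
    ((hS.posPart hSs).add (hT.posPart hTs)) ((hS.negPart hSs).add (hT.negPart hTs)),
    ω.tracePos_add (CFC.posPart_nonneg S) (CFC.posPart_nonneg T) (hS.posPart hSs) (hT.posPart hTs),
    ω.tracePos_add (CFC.negPart_nonneg S) (CFC.negPart_nonneg T) (hS.negPart hSs) (hT.negPart hTs),
    traceSA, traceSA]
  ring

theorem traceSA_neg (S : H →L[ℂ] H) : ω.traceSA (-S) = -ω.traceSA S := by
  rw [traceSA, traceSA, CFC.posPart_neg, CFC.negPart_neg]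
  ring

theorem traceSA_smul_of_nonneg {S : H →L[ℂ] H} (hSs : IsSelfAdjoint S) (hS : MemWeakSchatten 1 S)
    {r : ℝ} (hr : 0 ≤ r) : ω.traceSA (r • S) = r * ω.traceSA S := by
  have e : r • S = r • S⁺ - r • S⁻ := by
    rw [← smul_sub, CFC.posPart_sub_negPart S hSs]
  have hp := (hS.posPart hSs).smul r
  have hn := (hS.negPart hSs).smul r
  have tp := ω.tracePos_smul (hS.posPart hSs) hr
  have tn := ω.tracePos_smul (hS.negPart hSs) hr
  rw [Complex.coe_smul] at hp hn tp tn
  rw [e, ω.traceSA_sub_of_nonneg (smul_nonneg hr (CFC.posPart_nonneg S))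
    (smul_nonneg hr (CFC.negPart_nonneg S)) hp hn, tp, tn, traceSA]
  ring

theorem traceSA_smul {S : H →L[ℂ] H} (hSs : IsSelfAdjoint S) (hS : MemWeakSchatten 1 S) (r : ℝ) :
    ω.traceSA (r • S) = r * ω.traceSA S := by
  rcases le_total 0 r with hr | hr
  · exact ω.traceSA_smul_of_nonneg hSs hS hr
  · have := ω.traceSA_smul_of_nonneg hSs hS (neg_nonneg.mpr hr)
    rw [neg_smul, traceSA_neg] at this
    linarith

theorem trace_add {S T : H →L[ℂ] H} (hS : MemWeakSchatten 1 S) (hT : MemWeakSchatten 1 T) :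
    ω.trace (S + T) = ω.trace S + ω.trace T := by
  simp only [trace, map_add, AddSubgroup.coe_add]
  rw [ω.traceSA_add (ℜ S).2 (ℜ T).2 hS.realPart hT.realPart,
    ω.traceSA_add (ℑ S).2 (ℑ T).2 hS.imaginaryPart hT.imaginaryPart]
  push_cast
  ring

theorem trace_smul {T : H →L[ℂ] H} (hT : MemWeakSchatten 1 T) (z : ℂ) :
    ω.trace (z • T) = z * ω.trace T := by
  have hr : ∀ (r : ℝ) {S : H →L[ℂ] H}, MemWeakSchatten 1 S → MemWeakSchatten 1 (r • S) := by
    intro r S hS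
    rw [← Complex.coe_smul]
    exact hS.smul _
  have sr : ∀ r : ℝ, IsSelfAdjoint (r • (ℜ T : H →L[ℂ] H)) := fun r =>
    (r • ℜ T).2
  have si : ∀ r : ℝ, IsSelfAdjoint (r • (ℑ T : H →L[ℂ] H)) := fun r =>
    (r • ℑ T).2
  have er : (ℜ (z • T) : H →L[ℂ] H) =
      z.re • (ℜ T : H →L[ℂ] H) + (-z.im) • (ℑ T : H →L[ℂ] H) := by
    rw [realPart_smul, neg_smul, ← sub_eq_add_neg]
    rfl
  have ei : (ℑ (z • T) : H →L[ℂ] H) =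
      z.re • (ℑ T : H →L[ℂ] H) + z.im • (ℜ T : H →L[ℂ] H) := by
    rw [imaginaryPart_smul]
    rfl
  rw [trace, trace, er, ei]
  rw [ω.traceSA_add (sr _) (si _) (hr _ hT.realPart) (hr _ hT.imaginaryPart),
    ω.traceSA_add (si _) (sr _) (hr _ hT.imaginaryPart) (hr _ hT.realPart),
    ω.traceSA_smul (ℜ T).2 hT.realPart, ω.traceSA_smul (ℜ T).2 hT.realPart,
    ω.traceSA_smul (ℑ T).2 hT.imaginaryPart, ω.traceSA_smul (ℑ T).2 hT.imaginaryPart]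
  generalize ω.traceSA (ℜ T : H →L[ℂ] H) = a
  generalize ω.traceSA (ℑ T : H →L[ℂ] H) = b
  apply Complex.ext
  · simp
    ring
  · simp

/-- Dixmier traces vanish on operators with summable singular values. -/
theorem trace_eq_zero {T : H →L[ℂ] H} {C : ℝ} (hT : ∀ N, singSum T N ≤ C) : ω.trace T = 0 := by
  have key : ∀ S : H →L[ℂ] H, IsSelfAdjoint S → (∀ N, singSum S N ≤ 2 * C) →
      ω.traceSA S = 0 := by
    intro S hS h
    rw [traceSA, ω.tracePos_eq_zero (C := 4 * C) fun N => by
      linarith [singSum_posPart_le hS N, h N], ω.tracePos_eq_zero (C := 4 * C) fun N => by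
      linarith [singSum_negPart_le hS N, h N], sub_zero]
  rw [trace, key _ (ℜ T).2 fun N => by linarith [singSum_realPart_le T N, hT N],
    key _ (ℑ T).2 fun N => by linarith [singSum_imaginaryPart_le T N, hT N]]
  simp

theorem tracePos_unitary_conj {U : H →L[ℂ] H} (hU : U ∈ unitary (H →L[ℂ] H)) (T : H →L[ℂ] H) :
    ω.tracePos (U * T * star U) = ω.tracePos T := by
  simp only [tracePos, singSum_unitary_conj hU]

theorem traceSA_unitary_conj {U S : H →L[ℂ] H} (hU : U ∈ unitary (H →L[ℂ] H))
    (hSs : IsSelfAdjoint S) (hS : MemWeakSchatten 1 S) :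
    ω.traceSA (U * S * star U) = ω.traceSA S := by
  have e : U * S * star U = U * S⁺ * star U - U * S⁻ * star U := by
    rw [← sub_mul, ← mul_sub, CFC.posPart_sub_negPart S hSs]
  rw [e, ω.traceSA_sub_of_nonneg (star_right_conjugate_nonneg (CFC.posPart_nonneg S) U)
    (star_right_conjugate_nonneg (CFC.negPart_nonneg S) U)
    (((hS.posPart hSs).mul_left U).mul_right _) (((hS.negPart hSs).mul_left U).mul_right _),
    ω.tracePos_unitary_conj hU, ω.tracePos_unitary_conj hU, traceSA]

theorem trace_unitary_conj {U T : H →L[ℂ] H} (hU : U ∈ unitary (H →L[ℂ] H))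
    (hT : MemWeakSchatten 1 T) : ω.trace (U * T * star U) = ω.trace T := by
  have hr : (ℜ (U * T * star U) : H →L[ℂ] H) = U * (ℜ T : H →L[ℂ] H) * star U := by
    simp only [realPart_apply_coe, star_mul, star_star, mul_smul_comm, smul_mul_assoc, mul_add,
      add_mul, mul_assoc]
  have hi : (ℑ (U * T * star U) : H →L[ℂ] H) = U * (ℑ T : H →L[ℂ] H) * star U := by
    simp only [imaginaryPart_apply_coe, star_mul, star_star, mul_smul_comm, smul_mul_assoc, mul_sub,
      sub_mul, mul_assoc]
  rw [trace, trace, hr, hi, ω.traceSA_unitary_conj hU (ℜ T).2 hT.realPart,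
    ω.traceSA_unitary_conj hU (ℑ T).2 hT.imaginaryPart]

/-- Dixmier traces are traces: `Tr_ω (A T) = Tr_ω (T A)` for bounded `A` and `T ∈ 𝓛^{1,∞}`. -/
theorem trace_mul_comm (A : H →L[ℂ] H) {T : H →L[ℂ] H} (hT : MemWeakSchatten 1 T) :
    ω.trace (A * T) = ω.trace (T * A) := by
  have hA : A ∈ Submodule.span ℂ (unitary (H →L[ℂ] H) : Set (H →L[ℂ] H)) := by
    rw [CStarAlgebra.span_unitary]; trivial
  induction hA using Submodule.span_induction with
  | mem U hU =>
    -- Conjugating `T U` by `U` gives `U T`.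
    have := ω.trace_unitary_conj hU (hT.mul_right U)
    rwa [← mul_assoc, mul_assoc (U * T), Unitary.mul_star_self_of_mem hU, mul_one] at this
  | zero => rw [zero_mul, mul_zero]
  | add A B _ _ hA hB =>
    rw [add_mul, mul_add, ω.trace_add (hT.mul_left A) (hT.mul_left B),
      ω.trace_add (hT.mul_right A) (hT.mul_right B), hA, hB]
  | smul c A _ hA =>
    rw [smul_mul_assoc, mul_smul_comm, ω.trace_smul (hT.mul_left A), ω.trace_smul (hT.mul_right A),
      hA]

end DixmierLimit

/-! ## Powers of operators in `𝓛^{n,∞}` -/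

section Powers

variable {H : Type*} [NormedAddCommGroup H] [InnerProductSpace ℂ H]

theorem succ_mul_singVal_le_singSum (T : H →L[ℂ] H) (k : ℕ) :
    (k + 1) * singVal T k ≤ singSum T (k + 1) := by
  have := Finset.card_nsmul_le_sum (Finset.range (k + 1)) (singVal T) (singVal T k)
    fun i hi => singVal_antitone T (Finset.mem_range_succ_iff.mp hi)
  simpa [singSum] using this

theorem MemWeakSchatten.exists_singVal_le {n : ℕ} (hn : 2 ≤ n) {T : H →L[ℂ] H}
    (hT : MemWeakSchatten n T) :
    ∃ K : ℝ, 0 ≤ K ∧ ∀ k : ℕ, singVal T k ≤ K * ((k + 1 : ℕ) : ℝ) ^ (-(1 / (n : ℝ))) := by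
  obtain ⟨C, hC⟩ := hT
  refine ⟨max C ‖T‖, (norm_nonneg T).trans (le_max_right _ _), fun k => ?_⟩
  -- The growth condition starts at `N = 2`, so `μ_0` is bounded by the norm instead.
  rcases Nat.eq_zero_or_pos k with rfl | hk
  · simpa using Or.inr (singVal_le_norm T 0)
  · have h := (succ_mul_singVal_le_singSum T k).trans (hC (k + 1) (by omega))
    rw [if_neg (by omega), sub_eq_add_neg, Real.rpow_add (by positivity), Real.rpow_one] at h
    have hp : (0 : ℝ) < (k + 1 : ℕ) := by positivity
    have h' : ((k + 1 : ℕ) : ℝ) * singVal T k ≤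
        ((k + 1 : ℕ) : ℝ) * (C * ((k + 1 : ℕ) : ℝ) ^ (-(1 / (n : ℝ)))) := by
      calc ((k + 1 : ℕ) : ℝ) * singVal T k = (k + 1) * singVal T k := by push_cast; ring
        _ ≤ _ := h
        _ = _ := by ring
    exact (le_of_mul_le_mul_left h' hp).trans
      (mul_le_mul_of_nonneg_right (le_max_left _ _) (by positivity))

/-- For `p = 1` the partial sums only give `μ_k = O(log k / k)`. The exponent `3/4` is one choice
above `1/2`, enough to make the squares summable. -/
theorem MemWeakSchatten.exists_singVal_le_of_one {T : H →L[ℂ] H} (hT : MemWeakSchatten 1 T) :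
    ∃ K : ℝ, 0 ≤ K ∧ ∀ k : ℕ, singVal T k ≤ K * ((k + 1 : ℕ) : ℝ) ^ (-(3 / 4 : ℝ)) := by
  obtain ⟨C, hC⟩ := memWeakSchatten_one_iff.mp hT
  refine ⟨max (4 * |C|) ‖T‖, (norm_nonneg T).trans (le_max_right _ _), fun k => ?_⟩
  rcases Nat.eq_zero_or_pos k with rfl | hk
  · simpa using Or.inr (singVal_le_norm T 0)
  · have h := (succ_mul_singVal_le_singSum T k).trans (hC (k + 1) (by omega))
    have hp : (0 : ℝ) < (k + 1 : ℕ) := by positivity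
    have hlog := Real.log_le_rpow_div hp.le (show (0 : ℝ) < 1 / 4 by norm_num)
    have hlog0 := Real.log_natCast_nonneg (k + 1)
    have e : ((k + 1 : ℕ) : ℝ) ^ (1 / 4 : ℝ) =
        ((k + 1 : ℕ) : ℝ) * ((k + 1 : ℕ) : ℝ) ^ (-(3 / 4 : ℝ)) := by
      rw [← Real.rpow_one_add' hp.le (by norm_num)]
      norm_num
    rw [e] at hlog
    have h' : ((k + 1 : ℕ) : ℝ) * singVal T k ≤
        ((k + 1 : ℕ) : ℝ) * (4 * |C| * ((k + 1 : ℕ) : ℝ) ^ (-(3 / 4 : ℝ))) := by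
      calc ((k + 1 : ℕ) : ℝ) * singVal T k = (k + 1) * singVal T k := by push_cast; ring
        _ ≤ C * Real.log ((k + 1 : ℕ) : ℝ) := h
        _ ≤ |C| * Real.log ((k + 1 : ℕ) : ℝ) := by gcongr; exact le_abs_self C
        _ ≤ |C| * (((k + 1 : ℕ) : ℝ) * ((k + 1 : ℕ) : ℝ) ^ (-(3 / 4 : ℝ)) / (1 / 4)) := by gcongr
        _ = _ := by ring
    exact (le_of_mul_le_mul_left h' hp).trans
      (mul_le_mul_of_nonneg_right (le_max_left _ _) (by positivity))

/-- For `n ≥ 2`, `μ_{nk}(Tⁿ) ≤ μ_k(T)ⁿ = O(1 / (k + 1))`, and the harmonic sums grow like `log N`;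
for `n = 1` there is nothing to do. -/
theorem MemWeakSchatten.pow {n : ℕ} (hn : 0 < n) {T : H →L[ℂ] H} (hT : MemWeakSchatten n T) :
    MemWeakSchatten 1 (T ^ n) := by
  rcases Nat.lt_or_ge n 2 with h | h
  · obtain rfl : n = 1 := by omega
    rwa [pow_one]
  obtain ⟨K, hK0, hK⟩ := hT.exists_singVal_le h
  rw [memWeakSchatten_one_iff]
  refine ⟨n * (K ^ n * (1 / Real.log 2 + 1)), fun N hN => (singSum_le_mul_sum _ hn N).trans ?_⟩
  rw [mul_assoc]
  gcongr
  have hpow : ∀ k : ℕ, singVal (T ^ n) (n * k) ≤ K ^ n * ((k + 1 : ℕ) : ℝ)⁻¹ := by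
    intro k
    refine (singVal_pow_le T k n).trans
      ((pow_le_pow_left₀ (singVal_nonneg T k) (hK k) n).trans (le_of_eq ?_))
    rw [mul_pow, ← Real.rpow_natCast (_ ^ _) n, ← Real.rpow_mul (by positivity), neg_mul,
      one_div_mul_cancel (by positivity), Real.rpow_neg_one]
  have hharm : ∑ k ∈ Finset.range N, ((k + 1 : ℕ) : ℝ)⁻¹ ≤ 1 + Real.log N := by
    have := harmonic_le_one_add_log N
    rw [harmonic] at this
    push_cast at this ⊢
    exact this
  have h2 : 0 < Real.log 2 := Real.log_pos one_lt_two
  have hlog : Real.log 2 ≤ Real.log N := Real.log_le_log two_pos (by exact_mod_cast hN)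
  calc ∑ k ∈ Finset.range N, singVal (T ^ n) (n * k)
      ≤ ∑ k ∈ Finset.range N, K ^ n * ((k + 1 : ℕ) : ℝ)⁻¹ := Finset.sum_le_sum fun k _ => hpow k
    _ ≤ K ^ n * (1 + Real.log N) := by rw [← Finset.mul_sum]; gcongr
    _ ≤ K ^ n * ((1 / Real.log 2 + 1) * Real.log N) := by
      gcongr
      rw [add_mul, one_mul, one_div_mul_eq_div]
      gcongr
      rwa [one_le_div h2]
    _ = _ := by ring

theorem MemWeakSchatten.exists_sum_pow_le {n : ℕ} (hn : 0 < n) {T : H →L[ℂ] H}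
    (hT : MemWeakSchatten n T) :
    ∃ C : ℝ, ∀ N, ∑ k ∈ Finset.range N, singVal T k ^ (n + 1) ≤ C := by
  obtain ⟨K, s, hs, hK0, hK⟩ : ∃ K s : ℝ, 1 < s * (n + 1 : ℕ) ∧ 0 ≤ K ∧
      ∀ k : ℕ, singVal T k ≤ K * ((k + 1 : ℕ) : ℝ) ^ (-s) := by
    rcases Nat.lt_or_ge n 2 with h | h
    · obtain rfl : n = 1 := by omega
      obtain ⟨K, hK⟩ := hT.exists_singVal_le_of_one
      exact ⟨K, 3 / 4, by norm_num, hK⟩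
    · obtain ⟨K, hK⟩ := hT.exists_singVal_le h
      refine ⟨K, 1 / n, ?_, hK⟩
      rw [one_div_mul_eq_div, one_lt_div (by positivity)]
      push_cast
      linarith
  have hsum : Summable fun k : ℕ => ((k + 1 : ℕ) : ℝ) ^ (-(s * (n + 1 : ℕ))) :=
    (summable_nat_add_iff 1).mpr (Real.summable_nat_rpow.mpr (neg_lt_neg hs))
  refine ⟨K ^ (n + 1) * ∑' k : ℕ, ((k + 1 : ℕ) : ℝ) ^ (-(s * (n + 1 : ℕ))), fun N => ?_⟩
  calc ∑ k ∈ Finset.range N, singVal T k ^ (n + 1)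
      ≤ ∑ k ∈ Finset.range N, K ^ (n + 1) * ((k + 1 : ℕ) : ℝ) ^ (-(s * (n + 1 : ℕ))) := by
        refine Finset.sum_le_sum fun k _ =>
          (pow_le_pow_left₀ (singVal_nonneg T k) (hK k) _).trans (le_of_eq ?_)
        rw [mul_pow, ← Real.rpow_natCast (_ ^ _) (n + 1), ← Real.rpow_mul (by positivity), neg_mul]
    _ ≤ _ := by
        rw [← Finset.mul_sum]
        gcongr
        exact hsum.sum_le_tsum _ fun k _ => by positivity

theorem MemWeakSchatten.of_singSum_le_const {T : H →L[ℂ] H} {C : ℝ}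
    (h : ∀ N, singSum T N ≤ C) : MemWeakSchatten 1 T := by
  rw [memWeakSchatten_one_iff]
  have h2 : 0 < Real.log 2 := Real.log_pos one_lt_two
  refine ⟨C / Real.log 2, fun N hN => (h N).trans ?_⟩
  rw [div_mul_eq_mul_div, le_div_iff₀ h2]
  exact mul_le_mul_of_nonneg_left (Real.log_le_log two_pos (by exact_mod_cast hN))
    ((singSum_nonneg T 0).trans (h 0))

/-- The singular value of index `(n + 1) k` is at most `‖B‖ μ_k(T)^(n + 1)`. The one factor beyond
`n` turns logarithmic growth into convergence. -/
theorem MemWeakSchatten.exists_singSum_pow_mul_mul_pow_le {n : ℕ} (hn : 0 < n) {T : H →L[ℂ] H}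
    (hT : MemWeakSchatten n T) (B : H →L[ℂ] H) {i j : ℕ} (hij : i + j = n + 1) :
    ∃ C : ℝ, ∀ N, singSum (T ^ i * B * T ^ j) N ≤ C := by
  obtain ⟨C, hC⟩ := hT.exists_sum_pow_le hn
  refine ⟨(n + 1 : ℕ) * (‖B‖ * C), fun N => (singSum_le_mul_sum _ n.succ_pos N).trans ?_⟩
  gcongr
  refine le_trans ?_ (mul_le_mul_of_nonneg_left (hC N) (norm_nonneg B))
  rw [Finset.mul_sum]
  refine Finset.sum_le_sum fun k _ => ?_
  have hk := singVal_nonneg T k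
  rw [Nat.succ_eq_add_one, ← hij, add_mul, pow_add]
  refine (singVal_mul_le _ _ _ _).trans ?_
  calc singVal (T ^ i * B) (i * k) * singVal (T ^ j) (j * k)
      ≤ (singVal T k ^ i * ‖B‖) * singVal T k ^ j := by
        refine mul_le_mul ((singVal_mul_le_mul_norm _ _ _).trans ?_) (singVal_pow_le T k j)
          (singVal_nonneg _ _) (by positivity)
        exact mul_le_mul_of_nonneg_right (singVal_pow_le T k i) (norm_nonneg B)
    _ = _ := by ring

end Powers

/-! ## Twisted commutators -/

section TwistedCommutators

variable {H : Type*} [NormedAddCommGroup H] [InnerProductSpace ℂ H] {D : H →ₗ.[ℂ] H}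
  {S S' T T' B B' : H →L[ℂ] H}

theorem IsTwistedCommutator.unique (hD : Dense (D.domain : Set H))
    (h : IsTwistedCommutator D S T B) (h' : IsTwistedCommutator D S T B') : B = B' := by
  refine ContinuousLinearMap.ext fun x => ?_
  refine congrFun (Continuous.ext_on hD B.continuous B'.continuous fun y hy => ?_) x
  obtain ⟨_, e⟩ := h ⟨y, hy⟩
  obtain ⟨_, e'⟩ := h' ⟨y, hy⟩
  exact e.trans e'.symm

theorem IsTwistedCommutator.add (h : IsTwistedCommutator D S T B)
    (h' : IsTwistedCommutator D S' T' B') : IsTwistedCommutator D (S + S') (T + T') (B + B') := by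
  intro x
  obtain ⟨m, e⟩ := h x
  obtain ⟨m', e'⟩ := h' x
  refine ⟨D.domain.add_mem m m', ?_⟩
  have : (⟨(S + S') x, D.domain.add_mem m m'⟩ : D.domain) = ⟨S x, m⟩ + ⟨S' x, m'⟩ := rfl
  rw [this, D.map_add, add_apply, add_apply, e, e']
  abel

theorem IsTwistedCommutator.smul (h : IsTwistedCommutator D S T B) (c : ℂ) :
    IsTwistedCommutator D (c • S) (c • T) (c • B) := by
  intro x
  obtain ⟨m, e⟩ := h x
  refine ⟨D.domain.smul_mem c m, ?_⟩
  have : (⟨(c • S) x, D.domain.smul_mem c m⟩ : D.domain) = c • ⟨S x, m⟩ := rfl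
  rw [this, D.map_smul, smul_apply, smul_apply, e, smul_sub]

theorem IsTwistedCommutator.mul (h : IsTwistedCommutator D S T B)
    (h' : IsTwistedCommutator D S' T' B') :
    IsTwistedCommutator D (S * S') (T * T') (B * S' + T * B') := by
  intro x
  obtain ⟨m', e'⟩ := h' x
  obtain ⟨m, e⟩ := h ⟨S' x, m'⟩
  refine ⟨m, ?_⟩
  have e₁ : (B * S' + T * B') (x : H) = B (S' x) + T (B' x) := rfl
  have e₂ : (T * T') (D x) = T (T' (D x)) := rfl
  have e₃ : (⟨(S * S') x, m⟩ : D.domain) = ⟨S (S' x), m⟩ := rfl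
  rw [e₁, e₂, e₃, e', map_sub, e]
  abel

/-- On vectors `R y` the defining relation reads `B R y = D S R y - T y`; apply `R`. The hypothesis
on the unbounded operator thus becomes an identity between bounded ones. -/
theorem IsTwistedCommutator.mul_resolvent_sub {R : H →L[ℂ] H} (hR : IsResolvent D 0 R)
    (h : IsTwistedCommutator D S T B) : S * R - R * T = R * B * R := by
  refine ContinuousLinearMap.ext fun y => ?_
  obtain ⟨m, e⟩ := hR.1 y
  obtain ⟨m', e'⟩ := h ⟨R y, m⟩
  have hl := hR.2 ⟨S (R y), m'⟩
  rw [zero_smul, sub_zero] at e hl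
  rw [e] at e'
  have e₁ : (R * B * R) y = R (B (R y)) := rfl
  have e₂ : (S * R - R * T) y = S (R y) - R (T y) := rfl
  rw [e₁, e₂, e', map_sub, hl]

theorem isResolvent_boundedInverse (h : HasBoundedInverse D) :
    IsResolvent D 0 (boundedInverse D) := by
  rw [boundedInverse, dif_pos h]
  exact h.choose_spec

end TwistedCommutators

/-! ## Contractions of tuples -/

namespace Fin

variable {α : Type*}

theorem init_contractNth_castSucc {n : ℕ} (i : Fin (n + 1)) (op : α → α → α)
    (a : Fin (n + 3) → α) :
    init (contractNth i.castSucc.castSucc op a : Fin (n + 2) → α) =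
      contractNth i.castSucc op (init a) := by
  funext k
  simp [init, contractNth]

theorem contractNth_castSucc_last {n : ℕ} (i : Fin (n + 1)) (op : α → α → α)
    (a : Fin (n + 3) → α) :
    contractNth i.castSucc.castSucc op a (last (n + 1)) = a (last (n + 2)) :=
  contractNth_apply_of_gt _ _ _ _ i.2

theorem init_contractNth_last {n : ℕ} (op : α → α → α) (a : Fin (n + 3) → α) :
    init (contractNth (last (n + 1)).castSucc op a : Fin (n + 2) → α) =
      init (init a : Fin (n + 2) → α) := by
  funext k
  exact contractNth_apply_of_lt _ _ _ _ k.2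

theorem contractNth_last_last {n : ℕ} (op : α → α → α) (a : Fin (n + 3) → α) :
    contractNth (last (n + 1)).castSucc op a (last (n + 1)) =
      op (init a (last (n + 1))) (a (last (n + 2))) :=
  contractNth_apply_of_eq _ _ _ _ rfl

end Fin

namespace SigmaSpectralTriple

variable {A H : Type*} [NonUnitalRing A] [Module ℂ A] [IsScalarTower ℂ A A] [SMulCommClass ℂ A A]
  [NormedAddCommGroup H] [InnerProductSpace ℂ H] [CompleteSpace H] (𝒯 : SigmaSpectralTriple A H)

/-! ### The twisted derivation -/

theorem isTwistedCommutator_d (a : A) :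
    IsTwistedCommutator 𝒯.D (𝒯.π a) (𝒯.π (𝒯.σ a)) (𝒯.d a) :=
  (𝒯.bounded_twistedCommutator a).choose_spec

theorem d_eq {a : A} {B : H →L[ℂ] H} (h : IsTwistedCommutator 𝒯.D (𝒯.π a) (𝒯.π (𝒯.σ a)) B) :
    𝒯.d a = B :=
  (𝒯.isTwistedCommutator_d a).unique 𝒯.selfAdjoint.dense_domain h

theorem d_mul (a b : A) : 𝒯.d (a * b) = 𝒯.d a * 𝒯.π b + 𝒯.π (𝒯.σ a) * 𝒯.d b :=
  𝒯.d_eq <| by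
    simpa only [map_mul] using (𝒯.isTwistedCommutator_d a).mul (𝒯.isTwistedCommutator_d b)

/-- The twisted derivation `d_σ` as a linear map. -/
noncomputable def dLinear : A →ₗ[ℂ] (H →L[ℂ] H) where
  toFun := 𝒯.d
  map_add' a b := 𝒯.d_eq <| by
    simpa only [map_add] using (𝒯.isTwistedCommutator_d a).add (𝒯.isTwistedCommutator_d b)
  map_smul' c a := 𝒯.d_eq <| by
    simpa only [𝒯.σ_smul, map_smul, RingHom.id_apply] using (𝒯.isTwistedCommutator_d a).smul c

/-- The power `σ⁻ᵏ` of the automorphism `σ⁻¹` as a linear map. -/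
noncomputable def twist (k : ℕ) : A →ₗ[ℂ] A where
  toFun := 𝒯.σ.symm^[k]
  map_add' a b := iterate_map_add 𝒯.σ.symm k a b
  map_smul' c a := by
    have h : ∀ x : A, 𝒯.σ.symm (c • x) = c • 𝒯.σ.symm x := fun x => by
      rw [RingEquiv.symm_apply_eq, 𝒯.σ_smul, RingEquiv.apply_symm_apply]
    exact ((Function.Semiconj.iterate_right (f := fun x : A => c • x)
      (fun x => (h x).symm) k) a).symm

theorem twist_mul (k : ℕ) (a b : A) : 𝒯.twist k (a * b) = 𝒯.twist k a * 𝒯.twist k b :=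
  iterate_map_mul 𝒯.σ.symm k a b

theorem σ_twist_succ (k : ℕ) (a : A) : 𝒯.σ (𝒯.twist (k + 1) a) = 𝒯.twist k a := by
  change 𝒯.σ (𝒯.σ.symm^[k + 1] a) = 𝒯.σ.symm^[k] a
  rw [Function.iterate_succ_apply', RingEquiv.apply_symm_apply]

/-- The coefficient left of the second term carries `σ⁻ᵏ`, one power less than the slot: just the
twist left over on the right by the previous slot. -/
theorem d_twist_mul (k : ℕ) (a b : A) :
    𝒯.d (𝒯.twist (k + 1) (a * b)) = 𝒯.d (𝒯.twist (k + 1) a) * 𝒯.π (𝒯.twist (k + 1) b) +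
      𝒯.π (𝒯.twist k a) * 𝒯.d (𝒯.twist (k + 1) b) := by
  rw [twist_mul, d_mul, σ_twist_succ]

/-! ### The operator-valued cochain -/

/-- The operators `a⁰ d_σ(σ⁻¹(a¹)) ⋯ d_σ(σ⁻ⁿ(aⁿ))` as a multilinear map. -/
noncomputable def formMultilinear (n : ℕ) : MultilinearMap ℂ (fun _ : Fin (n + 1) => A) (H →L[ℂ] H) :=
  (MultilinearMap.mkPiAlgebraFin ℂ (n + 1) (H →L[ℂ] H)).compLinearMap
    (Fin.cons (α := fun _ => A →ₗ[ℂ] (H →L[ℂ] H)) (𝒯.π : A →ₗ[ℂ] (H →L[ℂ] H))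
      fun k => 𝒯.dLinear ∘ₗ 𝒯.twist ((k : ℕ) + 1))

theorem formMultilinear_apply (n : ℕ) (a : Fin (n + 1) → A) :
    𝒯.formMultilinear n a = 𝒯.form n a := by
  rw [formMultilinear, MultilinearMap.compLinearMap_apply, MultilinearMap.mkPiAlgebraFin_apply,
    List.ofFn_succ, List.prod_cons]
  rfl

theorem form_succ (n : ℕ) (a : Fin (n + 2) → A) :
    𝒯.form (n + 1) a =
      𝒯.form n (Fin.init a) * 𝒯.d (𝒯.twist (n + 1) (a (Fin.last (n + 1)))) := by
  rw [form, form, List.ofFn_succ', List.concat_eq_append, List.prod_append, List.prod_singleton,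
    mul_assoc]
  rfl

theorem form_cons_mul (n : ℕ) (b : A) (a : Fin (n + 1) → A) :
    𝒯.form n (Fin.cons (b * a 0) fun k => a k.succ) = 𝒯.π b * 𝒯.form n a := by
  rw [form, form, ← mul_assoc, ← map_mul]
  rfl

theorem sum_neg_one_pow_smul_form_contractNth (n : ℕ) (a : Fin (n + 2) → A) :
    ∑ i : Fin (n + 1), (-1 : ℂ) ^ (i : ℕ) • 𝒯.form n (Fin.contractNth i.castSucc (· * ·) a) =
      (-1 : ℂ) ^ n • (𝒯.form n (Fin.init a) * 𝒯.π (𝒯.twist n (a (Fin.last (n + 1))))) := by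
  induction n with
  | zero =>
    rw [Fin.sum_univ_succ, Finset.univ_eq_empty, Finset.sum_empty, add_zero, Fin.val_zero]
    simp only [form, List.ofFn_zero, List.prod_nil, mul_one, pow_zero, one_smul]
    exact map_mul 𝒯.π (a 0) (a 1)
  | succ n ih =>
    rw [Fin.sum_univ_castSucc]
    simp only [form_succ, Fin.init_contractNth_castSucc, Fin.contractNth_castSucc_last,
      Fin.init_contractNth_last, Fin.contractNth_last_last, Fin.val_castSucc, Fin.val_last,
      ← smul_mul_assoc]
    -- Contracting the last two entries gives two terms by the Leibniz rule. The one with `d` on the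
    -- last entry cancels the induction hypothesis; the other is the new boundary term.
    rw [← Finset.sum_mul, ih, d_twist_mul, pow_succ, mul_neg_one]
    simp only [neg_smul, neg_mul, smul_mul_assoc, mul_add, mul_assoc]
    abel

/-! ### The Hochschild cocycle -/

variable {𝒯}

theorem trace_mul_twist_mul_pow {n : ℕ} (hn : 0 < n) {R : H →L[ℂ] H} (hR : MemWeakSchatten n R)
    (hc : ∀ a, ∃ B : H →L[ℂ] H, 𝒯.π a * R - R * 𝒯.π (𝒯.σ a) = R * B * R) (ω : DixmierLimit)
    (X : H →L[ℂ] H) (b : A) :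
    ω.trace (X * 𝒯.π (𝒯.twist n b) * R ^ n) = ω.trace (X * R ^ n * 𝒯.π b) := by
  -- `m` factors `R` remain to be crossed and `j` have been. Membership in `𝓛^{1,∞}` is carried
  -- along, since additivity of the trace requires it at each step.
  suffices h : ∀ m j, m + j = n →
      MemWeakSchatten 1 (X * (R ^ j * 𝒯.π (𝒯.twist m b) * R ^ m)) ∧
      ω.trace (X * (R ^ j * 𝒯.π (𝒯.twist m b) * R ^ m)) = ω.trace (X * R ^ n * 𝒯.π b) by
    have := (h n 0 (add_zero n)).2
    rwa [pow_zero, one_mul, ← mul_assoc] at this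
  intro m
  induction m with
  | zero =>
    intro j hj
    obtain rfl : j = n := by omega
    rw [pow_zero, mul_one]
    exact ⟨((hR.pow hn).mul_right _).mul_left X, by rw [← mul_assoc]; rfl⟩
  | succ m ih =>
    intro j hj
    obtain ⟨h1, h2⟩ := ih (j + 1) (by omega)
    obtain ⟨B, hB⟩ := hc (𝒯.twist (m + 1) b)
    rw [σ_twist_succ, sub_eq_iff_eq_add] at hB
    obtain ⟨C, hC⟩ := hR.exists_singSum_pow_mul_mul_pow_le hn B
      (i := j + 1) (j := m + 1) (by omega)
    have hXC : ∀ N, singSum (X * (R ^ (j + 1) * B * R ^ (m + 1))) N ≤ ‖X‖ * C := fun N =>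
      (singSum_mul_le_norm_mul _ _ N).trans (mul_le_mul_of_nonneg_left (hC N) (norm_nonneg X))
    have e : X * (R ^ j * 𝒯.π (𝒯.twist (m + 1) b) * R ^ (m + 1)) =
        X * (R ^ (j + 1) * 𝒯.π (𝒯.twist m b) * R ^ m) +
          X * (R ^ (j + 1) * B * R ^ (m + 1)) := by
      rw [pow_succ' R m, mul_assoc (R ^ j), ← mul_assoc _ R, hB, pow_succ R j]
      noncomm_ring
    have hm := MemWeakSchatten.of_singSum_le_const hXC
    rw [e, ω.trace_add h1 hm, h2, ω.trace_eq_zero hXC, add_zero]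
    exact ⟨h1.add hm, rfl⟩

variable (𝒯)

theorem exists_hochschildCocycle {n : ℕ} (hn : 0 < n) {γ R : H →L[ℂ] H}
    (hγ : ∀ a, γ * 𝒯.π a = 𝒯.π a * γ) (hR : MemWeakSchatten n R)
    (hc : ∀ a, ∃ B : H →L[ℂ] H, 𝒯.π a * R - R * 𝒯.π (𝒯.σ a) = R * B * R) (ω : DixmierLimit) :
    (∀ a : Fin (n + 1) → A, MemWeakSchatten 1 (γ * 𝒯.form n a * R ^ n)) ∧
      ∃ Ψ : MultilinearMap ℂ (fun _ : Fin (n + 1) => A) ℂ,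
        (∀ a : Fin (n + 1) → A, Ψ a = ω.trace (γ * 𝒯.form n a * R ^ n)) ∧
          IsHochschildCocycle Ψ := by
  have hm : ∀ T : H →L[ℂ] H, MemWeakSchatten 1 (γ * T * R ^ n) := fun T => (hR.pow hn).mul_left _
  let F : (H →L[ℂ] H) →ₗ[ℂ] ℂ :=
    { toFun := fun T => ω.trace (γ * T * R ^ n)
      map_add' := fun S T => by rw [mul_add, add_mul, ω.trace_add (hm S) (hm T)]
      map_smul' := fun c T => by
        rw [mul_smul_comm, smul_mul_assoc, ω.trace_smul (hm T)]
        rfl }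
  have hΨ : ∀ a, F.compMultilinearMap (𝒯.formMultilinear n) a =
      ω.trace (γ * 𝒯.form n a * R ^ n) := fun a => by
    rw [← formMultilinear_apply]
    rfl
  refine ⟨fun a => hm _, F.compMultilinearMap (𝒯.formMultilinear n), hΨ, fun a => ?_⟩
  have hF : ∀ a, F.compMultilinearMap (𝒯.formMultilinear n) a = F (𝒯.form n a) := hΨ
  have h1 := congrArg F (𝒯.sum_neg_one_pow_smul_form_contractNth n a)
  simp only [map_sum, map_smul, smul_eq_mul] at h1
  have h2 := 𝒯.form_cons_mul n (a (Fin.last (n + 1))) (Fin.init a)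
  -- The last entry crosses `Rⁿ` and loses its twist, returns to the front by the trace property,
  -- and commutes with `γ`.
  have h3 : F (𝒯.form n (Fin.init a) * 𝒯.π (𝒯.twist n (a (Fin.last (n + 1))))) =
      F (𝒯.π (a (Fin.last (n + 1))) * 𝒯.form n (Fin.init a)) := by
    change ω.trace _ = ω.trace _
    rw [← mul_assoc γ, trace_mul_twist_mul_pow hn hR hc, ← ω.trace_mul_comm _ (hm _), ← mul_assoc γ,
      hγ, mul_assoc, mul_assoc, mul_assoc]
  rw [hochschildCoboundary]
  simp only [hF]
  rw [h1, h3, ← h2, pow_succ]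
  simp only [Fin.init]
  rw [mul_neg_one, neg_mul]
  exact add_neg_cancel _

end SigmaSpectralTriple

/-! ### The even and the odd case -/

theorem mainTheorem5 {A H : Type*} [NonUnitalRing A] [Module ℂ A] [IsScalarTower ℂ A A]
    [SMulCommClass ℂ A A] [NormedAddCommGroup H] [InnerProductSpace ℂ H] [CompleteSpace H] :
    (∀ (𝒯 : GradedSigmaSpectralTriple A H) (n : ℕ), 0 < n → Even n →
      𝒯.InverseMemWeakSchatten n → ∀ ω : DixmierLimit,
        (∀ a : Fin (n + 1) → A,
          MemWeakSchatten 1 (𝒯.γ * 𝒯.form n a * boundedInverse 𝒯.D ^ n)) ∧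
        ∃ Ψ : MultilinearMap ℂ (fun _ : Fin (n + 1) => A) ℂ,
          (∀ a : Fin (n + 1) → A,
            Ψ a = ω.trace (𝒯.γ * 𝒯.form n a * boundedInverse 𝒯.D ^ n)) ∧
          IsHochschildCocycle Ψ) ∧
    (∀ (𝒯 : SigmaSpectralTriple A H) (n : ℕ), Odd n →
      𝒯.InverseMemWeakSchatten n → 𝒯.LipschitzRegular → ∀ ω : DixmierLimit,
        (∀ a : Fin (n + 1) → A,
          MemWeakSchatten 1 (𝒯.form n a * absInverse 𝒯.D ^ n)) ∧
        ∃ Ψ : MultilinearMap ℂ (fun _ : Fin (n + 1) => A) ℂ,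
          (∀ a : Fin (n + 1) → A,
            Ψ a = ω.trace (𝒯.form n a * absInverse 𝒯.D ^ n)) ∧
          IsHochschildCocycle Ψ) := by
  constructor
  · intro 𝒯 n hn _ hD ω
    exact 𝒯.exists_hochschildCocycle hn 𝒯.γ_comm hD.2 (fun a =>
      ⟨_, (𝒯.isTwistedCommutator_d a).mul_resolvent_sub (isResolvent_boundedInverse hD.1)⟩) ω
  · intro 𝒯 n hn hD hL ω
    -- `|D|⁻¹ = |D⁻¹|` has the singular values of `D⁻¹`. Lipschitz regularity then supplies the
    -- commutation relation for `|D|⁻¹`, and the grading is replaced by `1`.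
    have hR : MemWeakSchatten n (absInverse 𝒯.D) :=
      hD.2.of_singSum_le zero_le_one fun N => by
        rw [one_mul, absInverse, singSum_cfcAbs]
    have h := 𝒯.exists_hochschildCocycle hn.pos (γ := 1) (fun a => by rw [one_mul, mul_one]) hR
      (fun a => (hL a).imp fun B hB =>
        hB.mul_resolvent_sub (unboundedAbs_spec 𝒯.selfAdjoint hD.1).2.2.2.2) ω
    simpa only [one_mul] using h
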